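/- \textbf{Setting.} Let $\mathcal F$ be the set of closed subsets of $\mathbb R^2$ with the hit-or-miss topology, generated by the sets $\{F : F\cap K=\emptyset\}$ ($K$ compact) and $\{F : F\cap G\neq\emptyset\}$ ($G$ open), and with its Borel $\sigma$-algebra; a random closed set is a random element of $\mathcal F$. Let $D(a)$ be the closed disk of radius $a$ centred at the origin, and let $\mathring A$ and $\partial A$ denote the interior and the topological boundary of $A\subset\mathbb R^2$. \textbf{Dead leaves model.} Let $X$ be a random closed set, let $\{(x_i,t_i)\}$ be a homogeneous Poisson point process of intensity one on $\mathbb R^2\times\mathbb R$, and let $(X_i)$ be i.i.d. random closed sets with the distribution of $X$, independent of the Poisson process. The visible parts of the dead leaves model $M=\{V_i\}_{t_i\le 0}$ associated with $X$ are $$V_i=(x_i+X_i)\setminus\bigcup_{t_j\in(t_i,0)}(x_j+\mathring X_j),$$ and its boundary is $\partial M=\bigcup_{t_i\le 0}\partial V_i$. \textbf{Grains.} Let $\alpha>1$, and let $r_1\in(0,\infty)$ if $\alpha\le 3$ and $r_1\in(0,\infty]$ if $\alpha>3$. Let $Y$ be a random compact set for which there are constants $0<a_1<a_2$ with $D(a_1)\subset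 Y\subset D(a_2)$ almost surely. For $0<r_0<r_1$ let $R$ be a random variable independent of $Y$ with probability density $$f(r_0,r_1,r)=\eta\, r^{-\alpha}\,\mathbf 1(r_0\le r\le r_1),\qquad \eta=\frac{\alpha-1}{r_0^{1-\alpha}-r_1^{1-\alpha}}\quad(\infty^{1-\alpha}:=0),$$ and let $M(r_0,r_1)$ be the dead leaves model associated with $X=RY$. \textbf{Proposition.} For every $r_0\in(0,r_1)$ the set $\partial M(r_0,r_1)$ is almost surely closed, and it is a random closed set. As $r_0\to0$, with $r_1$ fixed, $\partial M(r_0,r_1)$ converges weakly, as a random closed set, to the deterministic set $\mathbb R^2$. Moreover, for every closed disk $D$ of positive radius, the probability that $D\subset\mathring V_i$ for some visible part $V_i$ of $M(r_0,r_1)$ tends to $0$ as $r_0\to0$. -/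

import Mathlib

open MeasureTheory ProbabilityTheory Set Filter Topology
open scoped Pointwise ENNReal

noncomputable section

/-- The Euclidean plane. -/
abbrev Plane : Type := EuclideanSpace ℝ (Fin 2)

/-! ### Random closed sets -/

/-- The closed subsets of `E`. This is a type synonym of `TopologicalSpace.Closeds E`, so that it
carries the hit-or-miss (Fell) topology below rather than the Hausdorff or Vietoris one. -/
def ClosedSets (E : Type*) [TopologicalSpace E] : Type _ := TopologicalSpace.Closeds E

namespace ClosedSets

variable {E : Type*} [TopologicalSpace E]

instance : SetLike (ClosedSets E) E := inferInstanceAs (SetLike (TopologicalSpace.Closeds E) E)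

/-- A closed set, seen as a point of `ClosedSets E`. -/
def mk (s : Set E) (hs : IsClosed s) : ClosedSets E := (⟨s, hs⟩ : TopologicalSpace.Closeds E)

@[simp] theorem coe_mk (s : Set E) (hs : IsClosed s) : (mk s hs : Set E) = s := rfl

theorem isClosed (F : ClosedSets E) : IsClosed (F : Set E) :=
  TopologicalSpace.Closeds.isClosed (α := E) F

/-- The closed sets that miss `A`. -/
def missing (A : Set E) : Set (ClosedSets E) := {F | (F : Set E) ∩ A = ∅}

/-- The closed sets that hit `A`. -/
def hitting (A : Set E) : Set (ClosedSets E) := {F | ((F : Set E) ∩ A).Nonempty}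

/-- The hit-or-miss topology: generated by the sets of closed sets that miss a given compact set
and the sets of closed sets that hit a given open set. -/
instance : TopologicalSpace (ClosedSets E) :=
  TopologicalSpace.generateFrom
    ({U | ∃ K : Set E, IsCompact K ∧ U = missing K} ∪ {U | ∃ G : Set E, IsOpen G ∧ U = hitting G})

instance : MeasurableSpace (ClosedSets E) := borel (ClosedSets E)

instance : BorelSpace (ClosedSets E) := ⟨rfl⟩

/-- The set `r F = {r y | y ∈ F}`. -/
def scale (r : ℝ) (F : ClosedSets Plane) : ClosedSets Plane :=
  mk (r • (F : Set Plane)) (F.isClosed.smul₀ r)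

theorem isOpen_missing {K : Set E} (hK : IsCompact K) : IsOpen (missing K) :=
  TopologicalSpace.isOpen_generateFrom_of_mem (Or.inl ⟨K, hK, rfl⟩)

theorem isOpen_hitting {G : Set E} (hG : IsOpen G) : IsOpen (hitting G) :=
  TopologicalSpace.isOpen_generateFrom_of_mem (Or.inr ⟨G, hG, rfl⟩)

theorem continuousAt_scale (q : ℝ × ClosedSets Plane) (hq : q.1 ≠ 0) :
    ContinuousAt (fun q : ℝ × ClosedSets Plane => scale q.1 q.2) q := by
  obtain ⟨r, F⟩ := q
  simp only at hq
  refine TopologicalSpace.tendsto_nhds_generateFrom_iff.2 ?_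
  rintro U (⟨K, hK, rfl⟩ | ⟨G, hG, rfl⟩) hU
  · -- the compact set `K / s`, for `s` near `r`, stays away from `F`
    obtain ⟨δ, hδ, hball⟩ : ∃ δ > 0, ∀ s ∈ Metric.closedBall r δ,
        s ≠ 0 ∧ ∀ k ∈ K, s⁻¹ • k ∉ (F : Set Plane) := by
      have hev : ∀ᶠ s in 𝓝 r, ∀ k ∈ K, s⁻¹ • k ∉ (F : Set Plane) := by
        refine hK.eventually_forall_of_forall_eventually ?_
        intro k hk
        have hc : ContinuousAt (fun z : ℝ × Plane => z.1⁻¹ • z.2) (r, k) :=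
          (continuousAt_fst.inv₀ hq).smul continuousAt_snd
        refine hc.eventually (F.isClosed.isOpen_compl.mem_nhds ?_)
        intro hmem
        have : k ∈ ((scale r F : Set Plane) ∩ K) :=
          ⟨⟨r⁻¹ • k, hmem, smul_inv_smul₀ hq k⟩, hk⟩
        rw [show (scale r F : Set Plane) ∩ K = ∅ from hU] at this
        exact this
      have h1 : ∀ᶠ s in 𝓝 r, s ≠ 0 := isOpen_ne.mem_nhds hq
      have h2 := h1.and hev
      obtain ⟨δ, hδ, h⟩ := Metric.nhds_basis_closedBall.eventually_iff.1 h2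
      exact ⟨δ, hδ, fun s hs => h hs⟩
    have hK' : IsCompact ((fun z : ℝ × Plane => z.1⁻¹ • z.2) '' (Metric.closedBall r δ ×ˢ K)) := by
      refine ((isCompact_closedBall r δ).prod hK).image_of_continuousOn ?_
      intro z hz
      exact ((continuousAt_fst.inv₀ (hball _ hz.1).1).smul continuousAt_snd).continuousWithinAt
    have hF : F ∈ missing ((fun z : ℝ × Plane => z.1⁻¹ • z.2) '' (Metric.closedBall r δ ×ˢ K)) := by
      refine Set.eq_empty_iff_forall_notMem.2 ?_
      rintro _ ⟨hy, ⟨⟨s, k⟩, ⟨hs, hk⟩, rfl⟩⟩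
      exact (hball s hs).2 k hk hy
    filter_upwards [prod_mem_nhds (Metric.closedBall_mem_nhds r hδ)
      ((isOpen_missing hK').mem_nhds hF)] with ⟨s, F'⟩ ⟨hs, hF'⟩
    refine Set.eq_empty_iff_forall_notMem.2 ?_
    rintro _ ⟨⟨y, hy, rfl⟩, hk⟩
    have : y ∈ (F' : Set Plane) ∩
        (fun z : ℝ × Plane => z.1⁻¹ • z.2) '' (Metric.closedBall r δ ×ˢ K) :=
      ⟨hy, ⟨(s, s • y), ⟨hs, hk⟩, inv_smul_smul₀ (hball s hs).1 y⟩⟩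
    rw [show (F' : Set Plane) ∩
        (fun z : ℝ × Plane => z.1⁻¹ • z.2) '' (Metric.closedBall r δ ×ˢ K) = ∅ from hF'] at this
    exact this
  · obtain ⟨_, ⟨y, hy, rfl⟩, hG'⟩ := hU
    have hc : ContinuousAt (fun z : ℝ × Plane => z.1 • z.2) (r, y) := by fun_prop
    obtain ⟨A, hA, B, hB, hAB⟩ := mem_nhds_prod_iff.1 (hc (hG.mem_nhds hG'))
    obtain ⟨B', hB'B, hB'o, hyB'⟩ := mem_nhds_iff.1 hB
    have hF : F ∈ hitting B' := ⟨y, hy, hyB'⟩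
    filter_upwards [prod_mem_nhds hA ((isOpen_hitting hB'o).mem_nhds hF)]
      with ⟨s, F'⟩ ⟨hs, z, hz, hzB⟩
    exact ⟨s • z, ⟨z, hz, rfl⟩, hAB (Set.mk_mem_prod hs (hB'B hzB))⟩

theorem measurable_scale : Measurable fun q : ℝ × ClosedSets Plane => scale q.1 q.2 := by
  have h0 : MeasurableSet {q : ℝ × ClosedSets Plane | q.1 ≠ 0} :=
    (measurable_fst (measurableSet_singleton (0 : ℝ))).compl
  refine measurable_of_restrict_of_restrict_compl h0 ?_ ?_
  · refine Continuous.measurable ?_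
    refine continuous_iff_continuousAt.2 fun q => ?_
    exact (continuousAt_scale q.1 q.2).comp continuousAt_subtype_val
  · -- for `r = 0` the value is `{0}` or `∅`, according to whether `F` is empty
    classical
    have he : MeasurableSet {q : ({q : ℝ × ClosedSets Plane | q.1 ≠ 0}ᶜ : Set _) |
        q.1.2 ∈ hitting (Set.univ : Set Plane)} :=
      (measurable_snd.comp measurable_subtype_coe) (isOpen_hitting isOpen_univ).measurableSet
    have : ({q : ℝ × ClosedSets Plane | q.1 ≠ 0}ᶜ).domRestrict
        (fun q : ℝ × ClosedSets Plane => scale q.1 q.2) =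
        fun q => if q.1.2 ∈ hitting (Set.univ : Set Plane) then mk {0} isClosed_singleton
          else mk ∅ isClosed_empty := by
      funext ⟨⟨r, F⟩, hr⟩
      have hr : r = 0 := by simpa using hr
      subst hr
      refine SetLike.coe_injective ?_
      simp only [Set.domRestrict_apply, hitting, Set.inter_univ, Set.mem_ofPred_eq]
      split_ifs with hF
      · exact zero_smul_set hF
      · rw [Set.not_nonempty_iff_eq_empty] at hF
        simp only [scale, coe_mk, hF, Set.smul_set_empty]
    rw [this]
    exact Measurable.ite he measurable_const measurable_const

end ClosedSets

/-! ### The dead leaves model -/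

/-- The random points `p 0, p 1, …` form a Poisson point process with intensity measure `Λ`: the
number of points in a measurable set `B` of finite intensity has the Poisson distribution with
mean `Λ B`, and the numbers of points in disjoint sets are independent. (Points are indexed by `ℕ`,
so this is meant for `Λ` of infinite total mass.) -/
structure IsPoissonProcess {Ω E : Type*} [MeasurableSpace Ω] [MeasurableSpace E]
    (P : Measure Ω) (p : ℕ → Ω → E) (Λ : Measure E) : Prop where
  measurable : ∀ i, Measurable (p i)
  count_law : ∀ B : Set E, MeasurableSet B → Λ B ≠ ∞ → ∀ n : ℕ,
    P {ω | {i | p i ω ∈ B}.encard = n} =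
      ENNReal.ofReal (Real.exp (-(Λ B).toReal) * (Λ B).toReal ^ n / n.factorial)
  count_indep : ∀ (m : ℕ) (B : Fin m → Set E), (∀ k, MeasurableSet (B k)) → (∀ k, Λ (B k) ≠ ∞) →
    Pairwise (fun k l => Disjoint (B k) (B l)) →
    iIndepFun (fun k ω => {i | p i ω ∈ B k}.encard) P

/-- The random data of a dead leaves model whose grain has distribution `𝒳`: a homogeneous Poisson
process `(x i, t i)` of intensity one in `ℝ² × ℝ`, and independent random closed sets `X i` with
distribution `𝒳`, independent of the Poisson process. -/
structure IsDeadLeaves {Ω : Type*} [MeasurableSpace Ω] (P : Measure Ω)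
    (x : ℕ → Ω → Plane) (t : ℕ → Ω → ℝ) (X : ℕ → Ω → ClosedSets Plane)
    (𝒳 : Measure (ClosedSets Plane)) : Prop where
  poisson : IsPoissonProcess P (fun i ω => (x i ω, t i ω)) (volume : Measure (Plane × ℝ))
  grain_law : ∀ i, HasLaw (X i) 𝒳 P
  grain_indep : iIndepFun X P
  indep : IndepFun (fun ω i => (x i ω, t i ω)) (fun ω i => X i ω) P

/-- The visible part of the leaf `x i + X i`: what is left of it after removing the interiors of
the leaves that lie above it, i.e. those with `t j ∈ (t i, 0)`. -/
def visiblePart (x : ℕ → Plane) (t : ℕ → ℝ) (X : ℕ → ClosedSets Plane) (i : ℕ) : Set Plane :=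
  (x i +ᵥ (X i : Set Plane)) \ ⋃ j ∈ {j | t j ∈ Ioo (t i) 0}, (x j +ᵥ interior (X j : Set Plane))

/-- The union of the topological boundaries of the visible parts of the leaves fallen before
time `0`. -/
def boundarySet (x : ℕ → Plane) (t : ℕ → ℝ) (X : ℕ → ClosedSets Plane) : Set Plane :=
  ⋃ i ∈ {i | t i ≤ 0}, frontier (visiblePart x t X i)

/-- The boundary as a point of the space of closed sets. (The closure only serves to have a closed
set for every outcome.) -/
def boundary (x : ℕ → Plane) (t : ℕ → ℝ) (X : ℕ → ClosedSets Plane) : ClosedSets Plane :=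
  ClosedSets.mk (closure (boundarySet x t X)) isClosed_closure

/-! ### Grains with a power law of sizes -/

/-- The density `η r ^ (-α) 1(r₀ ≤ r ≤ r₁)`, where
`η = (α - 1) / (r₀ ^ (1 - α) - r₁ ^ (1 - α))` is the normalizing constant; for `r₁ = ∞` the term
`r₁ ^ (1 - α)` is `0`. -/
def sizeDensity (α r₀ : ℝ) (r₁ : ℝ≥0∞) (r : ℝ) : ℝ :=
  {r : ℝ | r₀ ≤ r ∧ ENNReal.ofReal r ≤ r₁}.indicator
    (fun r => (α - 1) / (r₀ ^ (1 - α) - (r₁ ^ (1 - α)).toReal) * r ^ (-α)) r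

/-- The distribution on `ℝ` with density `sizeDensity α r₀ r₁`. -/
def sizeLaw (α r₀ : ℝ) (r₁ : ℝ≥0∞) : Measure ℝ :=
  volume.withDensity fun r => ENNReal.ofReal (sizeDensity α r₀ r₁ r)

/-- The distribution of the grain `R Y`, where `R` has density `sizeDensity α r₀ r₁` and is
independent of `Y`, which has distribution `𝒴`. -/
def grainLaw (α r₀ : ℝ) (r₁ : ℝ≥0∞) (𝒴 : Measure (ClosedSets Plane)) :
    Measure (ClosedSets Plane) :=
  ((sizeLaw α r₀ r₁).prod 𝒴).map fun q => ClosedSets.scale q.1 q.2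

end

/-!
The boundary of the dead leaves model fills the plane as the smallest leaf size tends to `0`
because a given disk `D` is very unlikely to lie inside a single visible part. Looking back from
time `0`, within a long time span `T` some leaf is centred in the interior of `D`, except with the
Poisson void probability `exp (-T |D|)` (`measure_no_leaf`). That leaf interrupts all older ones
on `D`, so a visible part containing `D` comes from a leaf of the last `T` time units which itself
contains `D` and whose radius is thus bounded below by a positive `s`. By Campbell's formula
(`IsPoissonProcess.tsum_measure_marked_le`) the expected number of these leaves is at most a
constant times `T E[R² 1(R ≥ s)]`, and this truncated moment is the normalizing constant `η` times
an integral that is finite and does not depend on `r₀` (`lintegral_sq_sizeLaw_le`,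
`powerMoment_lt_top`). Since `η → 0` as `r₀ → 0` (`tendsto_sizeConst`), the probability tends to
`0`: first choose `T`, then let `r₀ → 0`.

For fixed `r₀`, every grain contains a fixed disk and `E[R²] < ∞`, so almost surely every disk is
covered by leaves of a bounded time span, and only finitely many leaves of this span hit it
(`ae_isLocallyFiniteCover`). Hence the visible parts, which are closed, are locally finite, the
union of their boundaries is closed, and a ball missed by this union lies, being connected, inside
one visible part (`IsLocallyFiniteCover.exists_ball_subset_interior`). So the probability of
missing a given ball tends to `0`, which is weak convergence to the whole plane, because the
neighbourhoods of the whole plane in the hit-or-miss topology are generated by hitting conditions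
(`ClosedSets.tendstoInDistribution_univ`).

Measurability of the boundary rests on the second countability of the hit-or-miss topology: a map
into the space of closed sets is measurable as soon as distances to its values are, and translates,
countable intersections, closures of complements and closed countable unions preserve this.
-/

namespace ClosedSets

/-! ### The space of closed sets and measurable maps into it -/

/-- The hit-or-miss topology of a locally compact second countable space is second countable: it is
generated by the sets missing the closure of a finite union of basic open sets and the sets hitting
a basic open set. -/
instance secondCountableTopology {E : Type*} [TopologicalSpace E] [SecondCountableTopology E]
    [LocallyCompactSpace E] [R1Space E] : SecondCountableTopology (ClosedSets E) := by
  let B := TopologicalSpace.countableBasis E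
  have hB : TopologicalSpace.IsTopologicalBasis B := TopologicalSpace.isBasis_countableBasis E
  have hBc : B.Countable := TopologicalSpace.countable_countableBasis E
  let S : Set (Set (ClosedSets E)) :=
    (fun s : Set (Set E) => missing (closure (⋃₀ s))) ''
      ({s | s.Finite ∧ s ⊆ B} ∩ {s | IsCompact (closure (⋃₀ s))}) ∪ hitting '' B
  have hS : S.Countable :=
    (((Set.countable_ofPred_finite_subset hBc).mono inter_subset_left).image _).union (hBc.image _)
  refine ⟨S, hS, le_antisymm ?_ ?_⟩
  · refine le_generateFrom ?_
    rintro _ (⟨s, ⟨-, hs⟩, rfl⟩ | ⟨U, hU, rfl⟩)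
    · exact isOpen_missing hs
    · exact isOpen_hitting (hB.isOpen hU)
  · refine le_generateFrom ?_
    rintro _ (⟨K, hK, rfl⟩ | ⟨G, hG, rfl⟩)
    · refine (@isOpen_iff_forall_mem_open _ (.generateFrom S) _).2 fun F hF => ?_
      have hKF : K ⊆ (F : Set E)ᶜ := fun y hy hyF => by
        have : y ∈ (F : Set E) ∩ K := ⟨hyF, hy⟩
        rw [show (F : Set E) ∩ K = ∅ from hF] at this
        exact this
      obtain ⟨V, hVo, hKV, hVF, hV⟩ :=
        exists_open_between_and_isCompact_closure hK F.isClosed.isOpen_compl hKF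
      obtain ⟨T, hTB, hVT⟩ := hB.open_eq_sUnion hVo
      obtain ⟨s, hsT, hsf, hKs⟩ := hK.elim_finite_subcover_image (b := T) (c := id)
        (fun U hU => hB.isOpen (hTB hU)) (by rwa [hVT, sUnion_eq_biUnion] at hKV)
      have hsV : ⋃₀ s ⊆ V := hVT ▸ sUnion_subset_sUnion hsT
      have hKs' : K ⊆ closure (⋃₀ s) := by
        rw [sUnion_eq_biUnion]
        exact hKs.trans subset_closure
      refine ⟨missing (closure (⋃₀ s)), fun F' hF' => ?_, ?_, ?_⟩
      · exact subset_empty_iff.1 ((inter_subset_inter_right _ hKs').trans (subset_of_eq hF'))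
      · exact .basic _ (Or.inl ⟨s, ⟨⟨hsf, hsT.trans hTB⟩,
          hV.of_isClosed_subset isClosed_closure (closure_mono hsV)⟩, rfl⟩)
      · refine eq_empty_iff_forall_notMem.2 fun y hy => ?_
        exact hVF (closure_mono hsV hy.2) hy.1
    · obtain ⟨T, hTB, rfl⟩ := hB.open_eq_sUnion hG
      have : (hitting (⋃₀ T) : Set (ClosedSets E)) = ⋃ U ∈ T, hitting U := by
        ext F
        simp only [hitting, mem_iUnion, mem_ofPred_eq, exists_prop, Set.Nonempty, mem_inter_iff,
          mem_sUnion]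
        tauto
      rw [this]
      refine @isOpen_biUnion _ _ (.generateFrom S) _ _ fun U hU => ?_
      exact .basic _ (Or.inr ⟨U, hTB hU, rfl⟩)

/-- A compact set meets the intersection of a sequence of closed sets as soon as there are points,
taken from a fixed dense sequence, that come arbitrarily close to the compact set and to all the
sets of any finite subfamily. -/
theorem inter_iInter_nonempty_iff {E : Type*} [MetricSpace E] [ProperSpace E] [Nonempty E]
    [TopologicalSpace.SeparableSpace E] {K : Set E} (hK : IsCompact K) {C : ℕ → Set E}
    (hC : ∀ n, IsClosed (C n)) :
    (K ∩ ⋂ n, C n).Nonempty ↔ ∀ n : ℕ, ∃ k : ℕ,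
      Metric.infEDist (TopologicalSpace.denseSeq E k) K < (n + 1 : ℝ≥0∞)⁻¹ ∧
      ∀ j ≤ n, Metric.infEDist (TopologicalSpace.denseSeq E k) (C j) < (n + 1 : ℝ≥0∞)⁻¹ := by
  have hpos (n : ℕ) : (0 : ℝ≥0∞) < (n + 1 : ℝ≥0∞)⁻¹ := ENNReal.inv_pos.2 (by finiteness)
  constructor
  · rintro ⟨y, hyK, hyC⟩ n
    obtain ⟨k, hk⟩ := (TopologicalSpace.denseRange_denseSeq E).exists_mem_open
      (Metric.isOpen_eball (x := y) (ε := (n + 1 : ℝ≥0∞)⁻¹)) ⟨y, Metric.mem_eball_self (hpos n)⟩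
    refine ⟨k, (Metric.infEDist_le_edist_of_mem hyK).trans_lt hk, fun j _ =>
      (Metric.infEDist_le_edist_of_mem (mem_iInter.1 hyC j)).trans_lt hk⟩
  · intro h
    choose k hkK hkC using h
    choose z hzK hz using fun n => Metric.infEDist_lt_iff.1 (hkK n)
    obtain ⟨y, hyK, φ, hφ, hy⟩ := hK.tendsto_subseq hzK
    refine ⟨y, hyK, mem_iInter.2 fun j => ?_⟩
    rw [Metric.mem_iff_infEDist_zero_of_closed (hC j)]
    have h1 : Tendsto (fun n => Metric.infEDist (z (φ n)) (C j)) atTop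
        (𝓝 (Metric.infEDist y (C j))) := (Metric.continuous_infEDist.tendsto y).comp hy
    have h0 : Tendsto (fun n : ℕ => ((φ n : ℝ≥0∞) + 1)⁻¹) atTop (𝓝 0) := by
      have := (ENNReal.tendsto_inv_nat_nhds_zero.comp (tendsto_add_atTop_nat 1)).comp
        hφ.tendsto_atTop
      refine this.congr fun n => ?_
      simp
    have h2 : Tendsto (fun n : ℕ => ((φ n : ℝ≥0∞) + 1)⁻¹ + ((φ n : ℝ≥0∞) + 1)⁻¹) atTop (𝓝 0) := by
      simpa using h0.add h0
    refine le_antisymm (le_of_tendsto_of_tendsto h1 h2 ?_) zero_le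
    filter_upwards [hφ.tendsto_atTop.eventually_ge_atTop j] with n hn
    refine (Metric.infEDist_le_infEDist_add_edist
      (y := TopologicalSpace.denseSeq E (k (φ n)))).trans ?_
    rw [edist_comm]
    exact add_le_add (hkC _ j hn).le (hz _).le

theorem isSigmaCompact_of_isOpen {E : Type*} [MetricSpace E] [ProperSpace E] {G : Set E}
    (hG : IsOpen G) : IsSigmaCompact G := by
  obtain ⟨C, hC, -, rfl, -⟩ := hG.exists_iUnion_isClosed
  exact isSigmaCompact_iUnion C fun n =>
    isSigmaCompact_univ.of_isClosed_subset (hC n) (subset_univ _)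

theorem infEDist_lt_iff_mem_hitting {E : Type*} [MetricSpace E] (F : ClosedSets E) (y : E)
    (ε : ℝ≥0∞) : Metric.infEDist y (F : Set E) < ε ↔ F ∈ hitting (Metric.eball y ε) := by
  rw [Metric.infEDist_lt_iff]
  simp only [hitting, Set.Nonempty, mem_ofPred_eq, mem_inter_iff, Metric.mem_eball, edist_comm]

section Measurability

variable {Ω : Type*} [MeasurableSpace Ω]
variable {E : Type*} [MetricSpace E] [ProperSpace E] [Nonempty E]

/-- A map into the space of closed sets is measurable if the distance of each point to its values
is a random variable. -/
theorem measurable_of_measurable_infEDist {f : Ω → ClosedSets E}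
    (hf : ∀ y, Measurable fun ω => Metric.infEDist y (f ω : Set E)) : Measurable f := by
  borelize E
  have hsub : (inferInstance : TopologicalSpace (ClosedSets E)) = .generateFrom
    ({U | ∃ K : Set E, IsCompact K ∧ U = missing K} ∪
      {U | ∃ G : Set E, IsOpen G ∧ U = hitting G}) := rfl
  have hcompact : ∀ K : Set E, IsCompact K → MeasurableSet {ω | (K ∩ (f ω : Set E)).Nonempty} := by
    intro K hK
    have : {ω | (K ∩ (f ω : Set E)).Nonempty} = ⋂ n : ℕ, ⋃ k : ℕ,
        {ω | Metric.infEDist (TopologicalSpace.denseSeq E k) K < (n + 1 : ℝ≥0∞)⁻¹ ∧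
          Metric.infEDist (TopologicalSpace.denseSeq E k) (f ω : Set E) < (n + 1 : ℝ≥0∞)⁻¹} := by
      ext ω
      have := inter_iInter_nonempty_iff hK (C := fun _ => (f ω : Set E)) fun _ => (f ω).isClosed
      rw [iInter_const] at this
      simp only [mem_iInter, mem_iUnion, mem_ofPred_eq]
      refine this.trans (forall_congr' fun n => exists_congr fun k => and_congr_right fun _ => ?_)
      exact ⟨fun h => h 0 (Nat.zero_le _), fun h _ _ => h⟩
    rw [this]
    refine MeasurableSet.iInter fun n => MeasurableSet.iUnion fun k => ?_
    exact (MeasurableSet.const _).inter (measurableSet_lt (hf _) measurable_const)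
  have hgen : (inferInstance : MeasurableSpace (ClosedSets E)) = .generateFrom
    ({U | ∃ K : Set E, IsCompact K ∧ U = missing K} ∪
      {U | ∃ G : Set E, IsOpen G ∧ U = hitting G}) := borel_eq_generateFrom_of_subbasis hsub
  refine @measurable_generateFrom _ _ _ _ f ?_ |>.mono le_rfl hgen.le
  rintro _ (⟨K, hK, rfl⟩ | ⟨G, hG, rfl⟩)
  · have : f ⁻¹' missing K = {ω | (K ∩ (f ω : Set E)).Nonempty}ᶜ := by
      ext ω
      simp [missing, inter_comm, not_nonempty_iff_eq_empty]
    rw [this]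
    exact (hcompact K hK).compl
  · obtain ⟨K, hK⟩ := isSigmaCompact_of_isOpen hG
    have : f ⁻¹' hitting G = ⋃ n, {ω | (K n ∩ (f ω : Set E)).Nonempty} := by
      ext ω
      simp only [hitting, mem_preimage, mem_ofPred_eq, ← hK.2, inter_iUnion, nonempty_iUnion,
        mem_iUnion, inter_comm (K _)]
    rw [this]
    exact MeasurableSet.iUnion fun n => hcompact _ (hK.1 n)

theorem measurable_infEDist_right {E : Type*} [MetricSpace E] (y : E) :
    Measurable fun F : ClosedSets E => Metric.infEDist y (F : Set E) := by
  refine measurable_of_Iio fun ε => ?_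
  have : (fun F : ClosedSets E => Metric.infEDist y (F : Set E)) ⁻¹' Iio ε
      = hitting (Metric.eball y ε) := by
    ext F
    exact infEDist_lt_iff_mem_hitting F y ε
  rw [this]
  exact (isOpen_hitting Metric.isOpen_eball).measurableSet

theorem measurable_infEDist_uncurry {E : Type*} [MetricSpace E] [ProperSpace E]
    [MeasurableSpace E] [BorelSpace E] :
    Measurable fun q : E × ClosedSets E => Metric.infEDist q.1 (q.2 : Set E) :=
  measurable_uncurry_of_continuous_of_measurable
    (u := fun (y : E) (F : ClosedSets E) => Metric.infEDist y (F : Set E))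
    (fun _ => Metric.continuous_infEDist) measurable_infEDist_right

/-- A map into the space of closed sets is measurable if the events of hitting open sets are. -/
theorem measurable_of_measurableSet_hitting {f : Ω → ClosedSets E}
    (hf : ∀ G, IsOpen G → MeasurableSet {ω | f ω ∈ hitting G}) : Measurable f := by
  refine measurable_of_measurable_infEDist fun y => measurable_of_Iio fun ε => ?_
  simpa only [preimage, mem_Iio, infEDist_lt_iff_mem_hitting] using hf _ Metric.isOpen_eball

theorem measurableSet_hitting {E : Type*} [TopologicalSpace E] {f : Ω → ClosedSets E}
    (hf : Measurable f) {G : Set E}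
    (hG : IsOpen G) : MeasurableSet {ω | f ω ∈ hitting G} :=
  hf (isOpen_hitting hG).measurableSet

/-- The intersection of a sequence of closed sets. -/
def seqInter {E : Type*} [TopologicalSpace E] (C : ℕ → ClosedSets E) : ClosedSets E :=
  mk (⋂ n, (C n : Set E)) (isClosed_iInter fun n => (C n).isClosed)

/-- The closure of the union of a sequence of closed sets. -/
def seqUnion {E : Type*} [TopologicalSpace E] (C : ℕ → ClosedSets E) : ClosedSets E :=
  mk (closure (⋃ n, (C n : Set E))) isClosed_closure

/-- The complement of the interior of a closed set, that is, the closure of its complement. -/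
def coInterior {E : Type*} [TopologicalSpace E] (F : ClosedSets E) : ClosedSets E :=
  mk (closure (F : Set E)ᶜ) isClosed_closure

/-- The topological boundary of a closed set. -/
def bdry {E : Type*} [TopologicalSpace E] (F : ClosedSets E) : ClosedSets E :=
  mk (frontier (F : Set E)) isClosed_frontier

theorem measurable_seqInter {C : Ω → ℕ → ClosedSets E} (hC : ∀ n, Measurable fun ω => C ω n) :
    Measurable fun ω => seqInter (C ω) := by
  borelize E
  refine measurable_of_measurableSet_hitting fun G hG => ?_
  obtain ⟨K, hK⟩ := isSigmaCompact_of_isOpen hG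
  have : {ω | seqInter (C ω) ∈ hitting G} = ⋃ m, ⋂ n : ℕ, ⋃ k : ℕ,
      {ω | Metric.infEDist (TopologicalSpace.denseSeq E k) (K m) < (n + 1 : ℝ≥0∞)⁻¹} ∩
      ⋂ j : ℕ, ⋂ _ : j ≤ n,
        {ω | Metric.infEDist (TopologicalSpace.denseSeq E k) (C ω j : Set E) <
          (n + 1 : ℝ≥0∞)⁻¹} := by
    ext ω
    simp only [hitting, mem_ofPred_eq, ← hK.2, inter_iUnion, nonempty_iUnion, mem_iUnion]
    refine exists_congr fun m => ?_
    rw [inter_comm]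
    refine (inter_iInter_nonempty_iff (hK.1 m) fun n => (C ω n).isClosed).trans ?_
    simp only [mem_iInter, mem_iUnion, mem_inter_iff, mem_ofPred_eq]
  rw [this]
  refine MeasurableSet.iUnion fun m => MeasurableSet.iInter fun n => MeasurableSet.iUnion fun k =>
    (MeasurableSet.const _).inter (MeasurableSet.iInter fun j => MeasurableSet.iInter fun _ => ?_)
  exact measurableSet_lt ((measurable_infEDist_right _).comp (hC j)) measurable_const

theorem measurable_seqUnion {C : Ω → ℕ → ClosedSets E} (hC : ∀ n, Measurable fun ω => C ω n) :
    Measurable fun ω => seqUnion (C ω) := by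
  refine measurable_of_measurableSet_hitting fun G hG => ?_
  have : {ω | seqUnion (C ω) ∈ hitting G} = ⋃ n, {ω | C ω n ∈ hitting G} := by
    ext ω
    simp only [hitting, seqUnion, coe_mk, mem_ofPred_eq, mem_iUnion,
      closure_inter_open_nonempty_iff hG, iUnion_inter, nonempty_iUnion]
  rw [this]
  exact MeasurableSet.iUnion fun n => measurableSet_hitting (hC n) hG

theorem measurable_coInterior : Measurable (coInterior : ClosedSets E → ClosedSets E) := by
  refine measurable_of_measurableSet_hitting fun G hG => ?_
  have : {F : ClosedSets E | coInterior F ∈ hitting G} =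
      ⋃ k, ⋃ _ : TopologicalSpace.denseSeq E k ∈ G, missing {TopologicalSpace.denseSeq E k} := by
    ext F
    simp only [hitting, coInterior, coe_mk, mem_ofPred_eq, mem_iUnion,
      closure_inter_open_nonempty_iff hG, missing, inter_singleton_eq_empty, exists_prop]
    constructor
    · intro h
      obtain ⟨k, hk⟩ := (TopologicalSpace.denseRange_denseSeq E).exists_mem_open
        (F.isClosed.isOpen_compl.inter hG) h
      exact ⟨k, hk.2, hk.1⟩
    · rintro ⟨k, hk, hkF⟩
      exact ⟨_, hkF, hk⟩
  rw [this]
  exact MeasurableSet.iUnion fun k => MeasurableSet.iUnion fun _ =>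
    (isOpen_missing isCompact_singleton).measurableSet

/-- The boundary is the intersection of the set with the closure of its complement. -/
theorem measurable_bdry : Measurable (bdry : ClosedSets E → ClosedSets E) := by
  have : (bdry : ClosedSets E → ClosedSets E) =
      fun F => seqInter fun n => if n = 0 then F else coInterior F := by
    funext F
    refine SetLike.coe_injective ?_
    simp only [bdry, seqInter, coe_mk]
    ext y
    rw [frontier_eq_closure_inter_closure, F.isClosed.closure_eq]
    simp only [mem_inter_iff, mem_iInter]
    constructor
    · rintro ⟨h, h'⟩ n
      split_ifs
      exacts [h, h']
    · intro h
      exact ⟨by simpa using h 0, by simpa [coInterior] using h 1⟩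
  rw [this]
  refine measurable_seqInter fun n => ?_
  split_ifs
  exacts [measurable_id, measurable_coInterior]

end Measurability

/-- The translate `x + F` of a closed set. -/
def translate {E : Type*} [NormedAddCommGroup E] (x : E) (F : ClosedSets E) : ClosedSets E :=
  mk (x +ᵥ (F : Set E)) (F.isClosed.vadd x)

theorem infEDist_translate {E : Type*} [NormedAddCommGroup E] (x y : E) (F : ClosedSets E) :
    Metric.infEDist y (translate x F : Set E) = Metric.infEDist (y - x) (F : Set E) := by
  have := Metric.infEDist_vadd x (y - x) (F : Set E)
  rwa [vadd_eq_add, add_sub_cancel] at this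

theorem measurable_translate {E : Type*} [NormedAddCommGroup E] [ProperSpace E]
    [MeasurableSpace E] [BorelSpace E] :
    Measurable fun q : E × ClosedSets E => translate q.1 q.2 := by
  refine measurable_of_measurable_infEDist fun y => ?_
  simp only [infEDist_translate]
  have hm : Measurable fun q : E × ClosedSets E => (y - q.1, q.2) :=
    (measurable_const.sub measurable_fst).prodMk measurable_snd
  exact measurable_infEDist_uncurry.comp hm

end ClosedSets

/-! ### Measurability of the boundary -/

open Classical in
/-- The visible part of a leaf as an intersection of closed sets: the leaf itself at index `0`, and
at index `j + 1` what the leaf `j` leaves uncovered, if it lies above. -/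
theorem visiblePart_eq_seqInter (x : ℕ → Plane) (t : ℕ → ℝ) (X : ℕ → ClosedSets Plane) (i : ℕ) :
    visiblePart x t X i = (ClosedSets.seqInter fun n => Nat.casesOn n
      (ClosedSets.translate (x i) (X i)) fun j =>
        if t j ∈ Ioo (t i) 0 then ClosedSets.coInterior (ClosedSets.translate (x j) (X j))
        else ClosedSets.mk univ isClosed_univ : ClosedSets Plane) := by
  ext y
  have hj (j : ℕ) : y ∈ ((if t j ∈ Ioo (t i) 0 then
      ClosedSets.coInterior (ClosedSets.translate (x j) (X j))
      else ClosedSets.mk univ isClosed_univ : ClosedSets Plane) : Set Plane) ↔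
      (t j ∈ Ioo (t i) 0 → y ∉ x j +ᵥ interior (X j : Set Plane)) := by
    split_ifs with h
    · simp only [ClosedSets.coInterior, ClosedSets.coe_mk, ClosedSets.translate, closure_compl,
        interior_vadd, mem_compl_iff, h, true_imp_iff]
    · simp only [ClosedSets.coe_mk, mem_univ, h, false_imp_iff]
  simp only [visiblePart, ClosedSets.seqInter, ClosedSets.coe_mk, mem_iInter, Set.mem_sdiff,
    mem_iUnion, exists_prop, mem_ofPred_eq, not_exists, not_and]
  constructor
  · rintro ⟨h0, h⟩ (_ | j)
    exacts [h0, (hj j).2 (h j)]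
  · exact fun h => ⟨h 0, fun j => (hj j).1 (h (j + 1))⟩

theorem isClosed_visiblePart (x : ℕ → Plane) (t : ℕ → ℝ) (X : ℕ → ClosedSets Plane) (i : ℕ) :
    IsClosed (visiblePart x t X i) := by
  rw [visiblePart_eq_seqInter]
  exact ClosedSets.isClosed _

open Classical in
theorem boundary_eq_seqUnion (x : ℕ → Plane) (t : ℕ → ℝ) (X : ℕ → ClosedSets Plane) :
    boundary x t X = ClosedSets.seqUnion fun i =>
      if t i ≤ 0 then ClosedSets.bdry
        (ClosedSets.mk (visiblePart x t X i) (isClosed_visiblePart x t X i))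
      else ClosedSets.mk ∅ isClosed_empty := by
  refine SetLike.coe_injective ?_
  simp only [boundary, ClosedSets.seqUnion, ClosedSets.coe_mk, boundarySet]
  congr 1
  refine iUnion_congr fun i => ?_
  by_cases h : t i ≤ 0 <;> simp [h, ClosedSets.bdry]

theorem measurable_boundary {Ω : Type*} [MeasurableSpace Ω] {x : ℕ → Ω → Plane} {t : ℕ → Ω → ℝ}
    {X : ℕ → Ω → ClosedSets Plane} (hx : ∀ i, Measurable (x i)) (ht : ∀ i, Measurable (t i))
    (hX : ∀ i, Measurable (X i)) :
    Measurable fun ω => boundary (fun i => x i ω) (fun i => t i ω) fun i => X i ω := by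
  classical
  have htr (i : ℕ) : Measurable fun ω => ClosedSets.translate (x i ω) (X i ω) :=
    ClosedSets.measurable_translate.comp ((hx i).prodMk (hX i))
  have hV (i : ℕ) : Measurable fun ω => ClosedSets.mk
      (visiblePart (fun i => x i ω) (fun i => t i ω) (fun i => X i ω) i)
      (isClosed_visiblePart _ _ _ i) := by
    have : (fun ω => ClosedSets.mk
        (visiblePart (fun i => x i ω) (fun i => t i ω) (fun i => X i ω) i)
        (isClosed_visiblePart _ _ _ i)) = fun ω => ClosedSets.seqInter fun n => Nat.casesOn n
      (ClosedSets.translate (x i ω) (X i ω)) fun j =>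
        if t j ω ∈ Ioo (t i ω) 0 then ClosedSets.coInterior (ClosedSets.translate (x j ω) (X j ω))
        else ClosedSets.mk univ isClosed_univ := by
      funext ω
      exact SetLike.coe_injective (visiblePart_eq_seqInter (fun i => x i ω) (fun i => t i ω)
        (fun i => X i ω) i)
    rw [this]
    refine ClosedSets.measurable_seqInter fun n => ?_
    cases n with
    | zero => exact htr i
    | succ j =>
      refine Measurable.ite ?_ (ClosedSets.measurable_coInterior.comp (htr j)) measurable_const
      exact (measurableSet_lt (ht i) (ht j)).inter (measurableSet_lt (ht j) measurable_const)
  simp only [boundary_eq_seqUnion]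
  exact ClosedSets.measurable_seqUnion fun i => Measurable.ite
    (measurableSet_le (ht i) measurable_const) (ClosedSets.measurable_bdry.comp (hV i))
    measurable_const

/-- The boundary of the dead leaves model is a random closed set. -/
theorem aemeasurable_boundary {Ω : Type*} [MeasurableSpace Ω] {P : Measure Ω} {x : ℕ → Ω → Plane}
    {t : ℕ → Ω → ℝ} {X : ℕ → Ω → ClosedSets Plane} (hx : ∀ i, Measurable (x i))
    (ht : ∀ i, Measurable (t i)) (hX : ∀ i, AEMeasurable (X i) P) :
    AEMeasurable (fun ω => boundary (fun i => x i ω) (fun i => t i ω) fun i => X i ω) P := by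
  refine ⟨_, measurable_boundary hx ht fun i => (hX i).measurable_mk, ?_⟩
  filter_upwards [ae_all_iff.2 fun i => (hX i).ae_eq_mk] with ω hω
  simp only [hω]

/-! ### Configurations with finitely many visible leaves in every disk -/

/-- Every disk is covered by the interiors of the leaves of a bounded time interval, and in a
bounded time interval only finitely many leaves hit a given disk. -/
structure IsLocallyFiniteCover (x : ℕ → Plane) (t : ℕ → ℝ) (X : ℕ → ClosedSets Plane) : Prop where
  cover : ∀ n : ℕ, ∃ T : ℕ, ∀ y ∈ Metric.closedBall (0 : Plane) n,
    ∃ j, t j ∈ Ioo (-T : ℝ) 0 ∧ y ∈ x j +ᵥ interior (X j : Set Plane)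
  finite : ∀ n T : ℕ, {i | t i ∈ Icc (-T : ℝ) 0 ∧
    ((x i +ᵥ (X i : Set Plane)) ∩ Metric.closedBall 0 n).Nonempty}.Finite

namespace IsLocallyFiniteCover

variable {x : ℕ → Plane} {t : ℕ → ℝ} {X : ℕ → ClosedSets Plane}

/-- Leaves older than the time span of a cover of the disk are hidden in the disk. -/
theorem finite_visible (h : IsLocallyFiniteCover x t X) (n : ℕ) :
    {i | t i ≤ 0 ∧ (visiblePart x t X i ∩ Metric.closedBall 0 n).Nonempty}.Finite := by
  obtain ⟨T, hT⟩ := h.cover n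
  refine (h.finite n T).subset ?_
  rintro i ⟨hi, y, ⟨hyX, hy⟩, hyn⟩
  refine ⟨⟨?_, hi⟩, y, hyX, hyn⟩
  by_contra! hlt
  obtain ⟨j, hj, hyj⟩ := hT y hyn
  exact hy (mem_iUnion₂.2 ⟨j, ⟨hlt.trans hj.1, hj.2⟩, hyj⟩)

theorem isClosed_boundarySet (h : IsLocallyFiniteCover x t X) :
    IsClosed (boundarySet x t X) := by
  have hlf : LocallyFinite fun i : {i | t i ≤ 0} => frontier (visiblePart x t X i) := by
    intro y
    obtain ⟨n, hn⟩ := exists_nat_gt (dist y 0)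
    refine ⟨Metric.closedBall 0 n, Metric.closedBall_mem_nhds_of_mem hn, ?_⟩
    refine Finite.of_finite_image ((h.finite_visible n).subset ?_)
      Subtype.val_injective.injOn
    rintro _ ⟨i, ⟨z, hz, hzn⟩, rfl⟩
    exact ⟨i.2, z, (isClosed_visiblePart x t X i).frontier_subset hz, hzn⟩
  rw [boundarySet, biUnion_eq_iUnion]
  exact hlf.isClosed_iUnion fun _ => isClosed_frontier

/-- The most recent leaf whose interior covers a point is visible at this point. -/
theorem exists_mem_visiblePart (h : IsLocallyFiniteCover x t X) (y : Plane) :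
    ∃ i, t i ≤ 0 ∧ y ∈ visiblePart x t X i := by
  obtain ⟨n, hn⟩ := exists_nat_ge (dist y 0)
  obtain ⟨T, hT⟩ := h.cover n
  let J : Set ℕ := {j | t j ∈ Ioo (-T : ℝ) 0 ∧ y ∈ x j +ᵥ interior (X j : Set Plane)}
  have hJ : J.Finite := (h.finite n T).subset fun j hj =>
    ⟨Ioo_subset_Icc_self hj.1, y, vadd_set_mono interior_subset hj.2, hn⟩
  obtain ⟨i, hi, hmax⟩ := Set.exists_max_image J t hJ (hT y hn)
  refine ⟨i, hi.1.2.le, vadd_set_mono interior_subset hi.2, ?_⟩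
  simp only [mem_iUnion, exists_prop, mem_ofPred_eq, not_exists, not_and]
  intro j hj hyj
  exact (hmax j ⟨⟨hi.1.1.trans hj.1, hj.2⟩, hyj⟩).not_gt hj.1

/-- A disk that the boundary misses lies in the interior of a single visible part, because the
disk is connected. -/
theorem exists_ball_subset_interior (h : IsLocallyFiniteCover x t X) {c : Plane} {r : ℝ}
    (hr : 0 < r) (hc : Disjoint (boundarySet x t X) (Metric.ball c r)) :
    ∃ i, t i ≤ 0 ∧ Metric.ball c r ⊆ interior (visiblePart x t X i) := by
  obtain ⟨i, hi, hci⟩ := h.exists_mem_visiblePart c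
  have hfr (y : Plane) (hy : y ∈ Metric.ball c r) : y ∉ frontier (visiblePart x t X i) :=
    fun hyf => disjoint_left.1 hc (mem_iUnion₂.2 ⟨i, hi, hyf⟩) hy
  have hint (y : Plane) (hy : y ∈ Metric.ball c r) (hyV : y ∈ visiblePart x t X i) :
      y ∈ interior (visiblePart x t X i) := by
    by_contra hyi
    exact hfr y hy ⟨subset_closure hyV, hyi⟩
  refine ⟨i, hi, (convex_ball c r).isPreconnected.subset_left_of_subset_union isOpen_interior
    (isClosed_visiblePart x t X i).isOpen_compl ?_ ?_ ?_⟩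
  · exact disjoint_compl_right.mono_left interior_subset
  · intro y hy
    by_cases hyV : y ∈ visiblePart x t X i
    exacts [Or.inl (hint y hy hyV), Or.inr hyV]
  · exact ⟨c, Metric.mem_ball_self hr, hint c (Metric.mem_ball_self hr) hci⟩

end IsLocallyFiniteCover

/-! ### Poisson processes -/

namespace IsPoissonProcess

variable {Ω E : Type*} [MeasurableSpace Ω] [MeasurableSpace E] {P : Measure Ω}
  {p : ℕ → Ω → E} {Λ : Measure E}

theorem hasSum_mul_poisson (l : ℝ) :
    HasSum (fun n : ℕ => (n : ℝ) * (Real.exp (-l) * l ^ n / n.factorial)) l := by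
  have h1 : HasSum (fun n : ℕ => l * (Real.exp (-l) * (l ^ n / n.factorial))) l := by
    have := ((NormedSpace.expSeries_div_hasSum_exp l).mul_left (Real.exp (-l))).mul_left l
    rwa [← Real.exp_eq_exp_ℝ, ← Real.exp_add, neg_add_cancel, Real.exp_zero, mul_one] at this
  rw [← hasSum_nat_add_iff' 1]
  simp only [Finset.range_one, Finset.sum_singleton, Nat.cast_zero, zero_mul, sub_zero]
  refine h1.congr_fun fun n => ?_
  rw [Nat.factorial_succ]
  push_cast
  field_simp
  ring

/-- The probability that a Poisson process has no point in a given set. -/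
theorem measure_forall_notMem (h : IsPoissonProcess P p Λ) {B : Set E} (hB : MeasurableSet B)
    (hΛ : Λ B ≠ ∞) : P {ω | ∀ i, p i ω ∉ B} = ENNReal.ofReal (Real.exp (-(Λ B).toReal)) := by
  have := h.count_law B hB hΛ 0
  simpa [Set.encard_eq_zero, Set.eq_empty_iff_forall_notMem] using this

/-- The expected number of points of a Poisson process in a set is the intensity of the set. -/
theorem tsum_measure_preimage [IsProbabilityMeasure P] (h : IsPoissonProcess P p Λ) {B : Set E}
    (hB : MeasurableSet B) (hΛ : Λ B ≠ ∞) : ∑' i, P (p i ⁻¹' B) = Λ B := by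
  set l := (Λ B).toReal with hl
  let N : Ω → ℝ≥0∞ := fun ω => ∑' i, (p i ⁻¹' B).indicator (fun _ => 1) ω
  have hpB (i : ℕ) : MeasurableSet (p i ⁻¹' B) := h.measurable i hB
  have hNm : Measurable N := Measurable.tsum fun i => measurable_const.indicator (hpB i)
  have hN (ω : Ω) : N ω = ({i | p i ω ∈ B}.encard : ℝ≥0∞) := by
    rw [← ENNReal.tsum_set_one, tsum_subtype {i | p i ω ∈ B} fun _ => (1 : ℝ≥0∞)]
    rfl
  let A : ℕ → Set Ω := fun n => {ω | {i | p i ω ∈ B}.encard = n}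
  have hA (n : ℕ) : A n = N ⁻¹' {(n : ℝ≥0∞)} := by
    ext ω
    simp only [A, mem_ofPred_eq, mem_preimage, mem_singleton_iff, hN]
    rw [← ENat.toENNReal_coe, ENat.toENNReal_inj]
  have hAm (n : ℕ) : MeasurableSet (A n) := hA n ▸ hNm (measurableSet_singleton _)
  have hAd : Pairwise fun m n => Disjoint (A m) (A n) := by
    intro m n hmn
    refine disjoint_left.2 fun ω hm hn => hmn ?_
    exact_mod_cast (show _ = _ from hm).symm.trans hn
  have hPA (n : ℕ) : P (A n) = ENNReal.ofReal (Real.exp (-l) * l ^ n / n.factorial) :=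
    h.count_law B hB hΛ n
  have hnn (n : ℕ) : 0 ≤ Real.exp (-l) * l ^ n / n.factorial := by positivity
  have hsum1 : HasSum (fun n : ℕ => Real.exp (-l) * l ^ n / n.factorial) 1 := by
    have := (NormedSpace.expSeries_div_hasSum_exp l).mul_left (Real.exp (-l))
    rw [← Real.exp_eq_exp_ℝ, ← Real.exp_add, neg_add_cancel, Real.exp_zero] at this
    exact this.congr_fun fun n => by ring
  have hae : ∀ᵐ ω ∂P, ω ∈ ⋃ n, A n := by
    refine (mem_ae_iff_prob_eq_one (MeasurableSet.iUnion hAm)).2 ?_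
    rw [measure_iUnion hAd hAm]
    simp_rw [hPA]
    rw [← ENNReal.ofReal_tsum_of_nonneg hnn hsum1.summable, hsum1.tsum_eq, ENNReal.ofReal_one]
  have hNae : N =ᵐ[P] fun ω => ∑' n : ℕ, (A n).indicator (fun _ => (n : ℝ≥0∞)) ω := by
    filter_upwards [hae] with ω hω
    obtain ⟨n, hn⟩ := mem_iUnion.1 hω
    rw [tsum_eq_single n fun m hm => indicator_of_notMem
      (fun hmω => disjoint_left.1 (hAd hm) hmω hn) _, indicator_of_mem hn]
    rw [hA] at hn
    exact hn
  calc ∑' i, P (p i ⁻¹' B) = ∫⁻ ω, N ω ∂P := by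
        rw [lintegral_tsum fun i => (measurable_const.indicator (hpB i)).aemeasurable]
        exact tsum_congr fun i => by rw [lintegral_indicator_const (hpB i), one_mul]
    _ = ∑' n : ℕ, (n : ℝ≥0∞) * P (A n) := by
        rw [lintegral_congr_ae hNae,
          lintegral_tsum fun n => (measurable_const.indicator (hAm n)).aemeasurable]
        exact tsum_congr fun n => lintegral_indicator_const (hAm n) _
    _ = ∑' n : ℕ, ENNReal.ofReal ((n : ℝ) * (Real.exp (-l) * l ^ n / n.factorial)) := by
        refine tsum_congr fun n => ?_
        rw [hPA, ENNReal.ofReal_mul (Nat.cast_nonneg n), ENNReal.ofReal_natCast]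
    _ = Λ B := by
        rw [← ENNReal.ofReal_tsum_of_nonneg (fun n => mul_nonneg (Nat.cast_nonneg n) (hnn n))
          (hasSum_mul_poisson l).summable, (hasSum_mul_poisson l).tsum_eq, hl,
          ENNReal.ofReal_toReal hΛ]

/-- Campbell's formula, as an inequality: for a Poisson process with marks of distribution `ν`,
each mark being independent of its point, the expected number of marked points in a set is at most
the product measure of the set. -/
theorem tsum_measure_marked_le [IsProbabilityMeasure P] [SFinite Λ] (h : IsPoissonProcess P p Λ)
    {F : Type*} [MeasurableSpace F] {ν : Measure F} {Y : ℕ → Ω → F}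
    (hY : ∀ i, HasLaw (Y i) ν P) (hind : ∀ i, IndepFun (p i) (Y i) P) {S : Set (E × F)}
    (hS : MeasurableSet S) : ∑' i, P {ω | (p i ω, Y i ω) ∈ S} ≤ (Λ.prod ν) S := by
  have : IsProbabilityMeasure ν := by
    rw [← (hY 0).map_eq]
    exact Measure.isProbabilityMeasure_map (hY 0).aemeasurable
  have hi (i : ℕ) : P {ω | (p i ω, Y i ω) ∈ S} =
      ∫⁻ y, P (p i ⁻¹' ((fun e => (e, y)) ⁻¹' S)) ∂ν := by
    have hpi := h.measurable i
    change P ((fun ω => (p i ω, Y i ω)) ⁻¹' S) = _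
    rw [← Measure.map_apply_of_aemeasurable
      (hpi.aemeasurable.prodMk (hY i).aemeasurable) hS,
      (hind i).map_prod_eq_prod_map_map hpi.aemeasurable (hY i).aemeasurable,
      (hY i).map_eq, Measure.prod_apply_symm hS]
    exact lintegral_congr fun y => Measure.map_apply hpi (hS.preimage measurable_prodMk_right)
  have hm (i : ℕ) : Measurable fun y => P (p i ⁻¹' ((fun e => (e, y)) ⁻¹' S)) := by
    convert! measurable_measure_prodMk_right (μ := P.map (p i)) hS using 2 with y
    exact (Measure.map_apply (h.measurable i) (hS.preimage measurable_prodMk_right)).symm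
  simp_rw [hi]
  rw [← lintegral_tsum fun i => (hm i).aemeasurable, Measure.prod_apply_symm hS]
  refine lintegral_mono fun y => ?_
  by_cases hΛ : Λ ((fun e => (e, y)) ⁻¹' S) = ∞
  · exact hΛ ▸ le_top
  · exact (h.tsum_measure_preimage (hS.preimage measurable_prodMk_right) hΛ).le

end IsPoissonProcess

namespace IsDeadLeaves

variable {Ω : Type*} [MeasurableSpace Ω] {P : Measure Ω} {x : ℕ → Ω → Plane} {t : ℕ → Ω → ℝ}
  {X : ℕ → Ω → ClosedSets Plane} {𝒳 : Measure (ClosedSets Plane)}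

theorem measurable_position (h : IsDeadLeaves P x t X 𝒳) (i : ℕ) : Measurable (x i) :=
  measurable_fst.comp (h.poisson.measurable i)

theorem measurable_time (h : IsDeadLeaves P x t X 𝒳) (i : ℕ) : Measurable (t i) :=
  measurable_snd.comp (h.poisson.measurable i)

theorem tsum_measure_le [IsProbabilityMeasure P] (h : IsDeadLeaves P x t X 𝒳)
    {S : Set ((Plane × ℝ) × ClosedSets Plane)} (hS : MeasurableSet S) :
    ∑' i, P {ω | ((x i ω, t i ω), X i ω) ∈ S} ≤
      ((volume : Measure (Plane × ℝ)).prod 𝒳) S :=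
  h.poisson.tsum_measure_marked_le h.grain_law
    (fun i => h.indep.comp (measurable_pi_apply i) (measurable_pi_apply i)) hS

end IsDeadLeaves

/-! ### The distribution of the grains -/

theorem measurableSet_sizeRange (s : ℝ) (r₁ : ℝ≥0∞) :
    MeasurableSet {r : ℝ | s ≤ r ∧ ENNReal.ofReal r ≤ r₁} :=
  (measurableSet_le measurable_const measurable_id).inter
    (measurableSet_le ENNReal.measurable_ofReal measurable_const)

theorem measurable_sizeDensity (α r₀ : ℝ) (r₁ : ℝ≥0∞) : Measurable (sizeDensity α r₀ r₁) := by
  unfold sizeDensity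
  exact (measurable_const.mul (measurable_id.pow_const _)).indicator (measurableSet_sizeRange r₀ r₁)

instance sFinite_sizeLaw (α r₀ : ℝ) (r₁ : ℝ≥0∞) : SFinite (sizeLaw α r₀ r₁) := by
  unfold sizeLaw
  infer_instance

theorem ae_le_sizeLaw (α r₀ : ℝ) (r₁ : ℝ≥0∞) : ∀ᵐ r ∂(sizeLaw α r₀ r₁), r₀ ≤ r := by
  rw [sizeLaw, ae_withDensity_iff (measurable_sizeDensity α r₀ r₁).ennreal_ofReal]
  refine ae_of_all _ fun r hr => ?_
  by_contra hlt
  exact hr (by rw [sizeDensity, indicator_of_notMem fun h => hlt h.1, ENNReal.ofReal_zero])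

/-- The normalizing constant of the size density. -/
noncomputable def sizeConst (α r₀ : ℝ) (r₁ : ℝ≥0∞) : ℝ :=
  (α - 1) / (r₀ ^ (1 - α) - (r₁ ^ (1 - α)).toReal)

/-- The second moment of the power law `r ^ (-α)`, restricted to sizes between `s` and `r₁`. -/
noncomputable def powerMoment (α s : ℝ) (r₁ : ℝ≥0∞) : ℝ≥0∞ :=
  ∫⁻ r in {r : ℝ | s ≤ r ∧ ENNReal.ofReal r ≤ r₁}, ENNReal.ofReal (r ^ (2 - α))

theorem powerMoment_lt_top {α s : ℝ} {r₁ : ℝ≥0∞}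
    (hα : (1 < α ∧ α ≤ 3 ∧ 0 < r₁ ∧ r₁ < ∞) ∨ (3 < α ∧ 0 < r₁)) (hs : 0 < s) :
    powerMoment α s r₁ < ∞ := by
  have hint : IntegrableOn (fun r : ℝ => r ^ (2 - α)) {r : ℝ | s ≤ r ∧ ENNReal.ofReal r ≤ r₁} := by
    rcases hα with ⟨-, -, -, hr⟩ | ⟨hα, -⟩
    · refine IntegrableOn.mono_set (t := Icc s r₁.toReal) ?_ fun r hr' =>
        ⟨hr'.1, (ENNReal.ofReal_le_iff_le_toReal hr.ne).1 hr'.2⟩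
      refine ContinuousOn.integrableOn_Icc fun r hr' => ?_
      exact (Real.continuousAt_rpow_const _ _ (Or.inl (hs.trans_le hr'.1).ne')).continuousWithinAt
    · exact (integrableOn_Ioi_rpow_of_lt (show 2 - α < -1 by linarith) (half_pos hs)).mono_set
        fun r hr => (half_lt_self hs).trans_le hr.1
  exact hint.lintegral_lt_top

/-- The truncated second moment of the radius is the normalizing constant times a quantity that
does not depend on `r₀`. -/
theorem lintegral_sq_sizeLaw_le {α r₀ s : ℝ} {r₁ : ℝ≥0∞} (hs : 0 < s) :
    ∫⁻ r, (Ici s).indicator (fun r => ENNReal.ofReal (r ^ 2)) r ∂(sizeLaw α r₀ r₁) ≤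
      ENNReal.ofReal (sizeConst α r₀ r₁) * powerMoment α s r₁ := by
  have hm : Measurable ((Ici s).indicator fun r : ℝ => ENNReal.ofReal (r ^ 2)) :=
    (measurable_id.pow_const 2).ennreal_ofReal.indicator measurableSet_Ici
  rw [sizeLaw, lintegral_withDensity_eq_lintegral_mul _
    (measurable_sizeDensity α r₀ r₁).ennreal_ofReal hm, powerMoment,
    ← lintegral_indicator (measurableSet_sizeRange s r₁),
    ← lintegral_const_mul' _ _ ENNReal.ofReal_ne_top]
  refine lintegral_mono fun r => ?_
  simp only [Pi.mul_apply]
  by_cases hrs : s ≤ r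
  · by_cases hr : r₀ ≤ r ∧ ENNReal.ofReal r ≤ r₁
    · have hr0 : 0 < r := hs.trans_le hrs
      rw [sizeDensity,
        indicator_of_mem (show r ∈ {r : ℝ | r₀ ≤ r ∧ ENNReal.ofReal r ≤ r₁} from hr),
        indicator_of_mem (mem_Ici.2 hrs),
        indicator_of_mem (show r ∈ {r : ℝ | s ≤ r ∧ ENNReal.ofReal r ≤ r₁} from ⟨hrs, hr.2⟩),
        ← ENNReal.ofReal_mul' (by positivity), ← ENNReal.ofReal_mul' (by positivity), mul_assoc,
        ← Real.rpow_natCast r 2, ← Real.rpow_add hr0]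
      refine le_of_eq (congrArg ENNReal.ofReal ?_)
      rw [sizeConst]
      congr 2
      push_cast
      ring
    · rw [sizeDensity,
        indicator_of_notMem (show r ∉ {r : ℝ | r₀ ≤ r ∧ ENNReal.ofReal r ≤ r₁} from hr),
        ENNReal.ofReal_zero, zero_mul]
      exact zero_le
  · rw [indicator_of_notMem (show r ∉ Ici s from hrs), mul_zero]
    exact zero_le

theorem tendsto_sizeConst {α : ℝ} (hα : 1 < α) (r₁ : ℝ≥0∞) :
    Tendsto (fun r₀ => sizeConst α r₀ r₁) (𝓝[>] 0) (𝓝 0) := by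
  unfold sizeConst
  refine Tendsto.const_div_atTop ?_ _
  refine tendsto_atTop_add_const_right _ _ ?_
  exact tendsto_rpow_neg_nhdsGT_zero (by linarith)

theorem measurableSet_superset {G : Set Plane} (hG : IsOpen G) :
    MeasurableSet {F : ClosedSets Plane | G ⊆ (F : Set Plane)} := by
  have : {F : ClosedSets Plane | G ⊆ (F : Set Plane)} =
      {F | ClosedSets.coInterior F ∈ ClosedSets.hitting G}ᶜ := by
    ext F
    simp only [ClosedSets.hitting, ClosedSets.coInterior, ClosedSets.coe_mk, mem_ofPred_eq,
      mem_compl_iff, closure_inter_open_nonempty_iff hG, not_nonempty_iff_eq_empty]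
    rw [← disjoint_iff_inter_eq_empty, disjoint_compl_left_iff_subset]
  rw [this]
  exact (ClosedSets.measurableSet_hitting ClosedSets.measurable_coInterior hG).compl

section GrainLaw

variable {α r₀ a₁ a₂ : ℝ} {r₁ : ℝ≥0∞} {𝒴 : Measure (ClosedSets Plane)}

/-- Almost surely the radius is at least `r₀` and the unscaled grain lies between two disks. -/
theorem ae_sizeLaw_prod (hY : ∀ᵐ (F : ClosedSets Plane) ∂𝒴,
      Metric.closedBall (0 : Plane) a₁ ⊆ (F : Set Plane) ∧ (F : Set Plane) ⊆ Metric.closedBall 0 a₂)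
    {p : ℝ → ClosedSets Plane → Prop}
    (hp : ∀ (r : ℝ) (F : ClosedSets Plane), r₀ ≤ r → Metric.closedBall 0 a₁ ⊆ (F : Set Plane) →
      (F : Set Plane) ⊆ Metric.closedBall 0 a₂ → p r F) :
    ∀ᵐ q ∂((sizeLaw α r₀ r₁).prod 𝒴), p q.1 q.2 := by
  filter_upwards [Measure.quasiMeasurePreserving_fst.ae (ae_le_sizeLaw α r₀ r₁),
    Measure.quasiMeasurePreserving_snd.ae hY] with q h1 h2
  exact hp q.1 q.2 h1 h2.1 h2.2

theorem ae_ball_subset_grainLaw [SFinite 𝒴] (hr₀ : 0 < r₀) (ha₁ : 0 < a₁)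
    (hY : ∀ᵐ (F : ClosedSets Plane) ∂𝒴,
      Metric.closedBall (0 : Plane) a₁ ⊆ (F : Set Plane) ∧
        (F : Set Plane) ⊆ Metric.closedBall 0 a₂) :
    ∀ᵐ (F : ClosedSets Plane) ∂(grainLaw α r₀ r₁ 𝒴),
      Metric.ball (0 : Plane) (r₀ * a₁) ⊆ (F : Set Plane) := by
  rw [grainLaw, ae_map_iff ClosedSets.measurable_scale.aemeasurable
    (measurableSet_superset Metric.isOpen_ball)]
  refine ae_sizeLaw_prod hY (p := fun r F => Metric.ball (0 : Plane) (r₀ * a₁) ⊆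
    (ClosedSets.scale r F : Set Plane)) fun r F hr hF _ => ?_
  have hr' : 0 < r := hr₀.trans_le hr
  calc Metric.ball (0 : Plane) (r₀ * a₁) ⊆ Metric.closedBall 0 (r * a₁) :=
        (Metric.ball_subset_ball (by gcongr)).trans Metric.ball_subset_closedBall
    _ = r • Metric.closedBall (0 : Plane) a₁ := by
        rw [smul_closedBall _ _ ha₁.le, smul_zero, Real.norm_of_nonneg hr'.le]
    _ ⊆ r • (F : Set Plane) := smul_set_mono hF

theorem scale_subset_closedBall {r : ℝ} {F : ClosedSets Plane} (hr : 0 < r) (ha₂ : 0 < a₂)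
    (hF : (F : Set Plane) ⊆ Metric.closedBall 0 a₂) :
    (ClosedSets.scale r F : Set Plane) ⊆ Metric.closedBall 0 (r * a₂) := by
  refine (smul_set_mono hF : r • (F : Set Plane) ⊆ _).trans ?_
  rw [smul_closedBall _ _ ha₂.le, smul_zero, Real.norm_of_nonneg hr.le]

/-- If the possible positions and times of a leaf of radius `r` have measure at most
`C r² 1(r ≥ s)`, then the expected number of leaves is at most `C E[R² 1(R ≥ s)]`. -/
theorem prod_grainLaw_le [IsProbabilityMeasure 𝒴] (hr₀ : 0 < r₀) (ha₂ : 0 < a₂)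
    (hY : ∀ᵐ (F : ClosedSets Plane) ∂𝒴,
      Metric.closedBall (0 : Plane) a₁ ⊆ (F : Set Plane) ∧ (F : Set Plane) ⊆ Metric.closedBall 0 a₂)
    {S : Set ((Plane × ℝ) × ClosedSets Plane)} (hS : MeasurableSet S) {s : ℝ} (hs : 0 < s)
    {C : ℝ≥0∞} (hC : ∀ (r : ℝ) (F : ClosedSets Plane), r₀ ≤ r →
      (F : Set Plane) ⊆ Metric.closedBall 0 (r * a₂) →
      (volume : Measure (Plane × ℝ)) {z | (z, F) ∈ S} ≤
        C * (Ici s).indicator (fun r => ENNReal.ofReal (r ^ 2)) r) :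
    ((volume : Measure (Plane × ℝ)).prod (grainLaw α r₀ r₁ 𝒴)) S ≤
      C * (ENNReal.ofReal (sizeConst α r₀ r₁) * powerMoment α s r₁) := by
  have : SFinite (grainLaw α r₀ r₁ 𝒴) := by unfold grainLaw; infer_instance
  have hm : Measurable ((Ici s).indicator fun r : ℝ => ENNReal.ofReal (r ^ 2)) :=
    (measurable_id.pow_const 2).ennreal_ofReal.indicator measurableSet_Ici
  rw [Measure.prod_apply_symm hS, grainLaw,
    lintegral_map (measurable_measure_prodMk_right hS) ClosedSets.measurable_scale]
  calc _ ≤ ∫⁻ q, C * (Ici s).indicator (fun r => ENNReal.ofReal (r ^ 2)) q.1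
        ∂((sizeLaw α r₀ r₁).prod 𝒴) := by
        refine lintegral_mono_ae (ae_sizeLaw_prod hY (p := fun r F =>
          (volume : Measure (Plane × ℝ)) {z | (z, ClosedSets.scale r F) ∈ S} ≤
          C * (Ici s).indicator (fun r => ENNReal.ofReal (r ^ 2)) r) fun r F hr _ hF => ?_)
        exact hC r _ hr (scale_subset_closedBall (hr₀.trans_le hr) ha₂ hF)
    _ = C * ∫⁻ r, (Ici s).indicator (fun r => ENNReal.ofReal (r ^ 2)) r ∂(sizeLaw α r₀ r₁) := by
        have hm' : Measurable fun q : ℝ × ClosedSets Plane =>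
            C * (Ici s).indicator (fun r => ENNReal.ofReal (r ^ 2)) q.1 :=
          (hm.const_mul C).comp measurable_fst
        refine (lintegral_prod _ hm'.aemeasurable).trans ?_
        simp only [lintegral_const, measure_univ, mul_one]
        exact lintegral_const_mul _ hm
    _ ≤ _ := by gcongr; exact lintegral_sq_sizeLaw_le hs

end GrainLaw

/-- The measure of a cylinder over a disk. -/
theorem volume_closedBall_prod_Icc (c : Plane) {ρ : ℝ} (hρ : 0 ≤ ρ) (T : ℕ) :
    (volume : Measure (Plane × ℝ)) (Metric.closedBall c ρ ×ˢ Icc (-T : ℝ) 0) =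
      ENNReal.ofReal (ρ ^ 2) * (volume (Metric.ball (0 : Plane) 1) * T) := by
  rw [Measure.volume_eq_prod, Measure.prod_prod, Measure.addHaar_closedBall _ _ hρ,
    Real.volume_Icc, finrank_euclideanSpace_fin, mul_assoc, sub_neg_eq_add, zero_add,
    ENNReal.ofReal_natCast]

/-! ### Almost sure properties of the dead leaves model -/

section DeadLeaves

variable {α r₀ a₁ a₂ : ℝ} {r₁ : ℝ≥0∞} {𝒴 : Measure (ClosedSets Plane)} [IsProbabilityMeasure 𝒴]
  {Ω : Type*} [MeasurableSpace Ω] {P : Measure Ω}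
  {x : ℕ → Ω → Plane} {t : ℕ → Ω → ℝ} {X : ℕ → Ω → ClosedSets Plane}

/-- The area of a disk, as a real number. -/
noncomputable def diskArea (δ : ℝ) : ℝ := (volume (Metric.ball (0 : Plane) δ)).toReal

theorem diskArea_pos {δ : ℝ} (hδ : 0 < δ) : 0 < diskArea δ :=
  ENNReal.toReal_pos (Metric.measure_ball_pos _ _ hδ).ne' measure_ball_lt_top.ne

/-- The probability that no leaf is centred in a given disk during a given time interval. -/
theorem measure_no_leaf {𝒳 : Measure (ClosedSets Plane)} (h : IsDeadLeaves P x t X 𝒳) (c : Plane)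
    (δ : ℝ) (T : ℕ) : P {ω | ∀ i, ¬ (x i ω ∈ Metric.ball c δ ∧ t i ω ∈ Ioo (-T : ℝ) 0)} =
      ENNReal.ofReal (Real.exp (-(diskArea δ * T))) := by
  have hvol : (volume : Measure (Plane × ℝ)) (Metric.ball c δ ×ˢ Ioo (-T : ℝ) 0) =
      volume (Metric.ball (0 : Plane) δ) * T := by
    rw [Measure.volume_eq_prod, Measure.prod_prod, Measure.addHaar_ball_center, Real.volume_Ioo,
      sub_neg_eq_add, zero_add, ENNReal.ofReal_natCast]
  have := h.poisson.measure_forall_notMem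
    (Metric.isOpen_ball.measurableSet.prod measurableSet_Ioo : MeasurableSet
      (Metric.ball c δ ×ˢ Ioo (-T : ℝ) 0))
    (hvol ▸ ENNReal.mul_ne_top measure_ball_lt_top.ne (ENNReal.natCast_ne_top T))
  rw [hvol, ENNReal.toReal_mul, ENNReal.toReal_natCast] at this
  simpa only [mem_prod, diskArea] using this

theorem tendsto_exp_neg_diskArea_mul {δ : ℝ} (hδ : 0 < δ) :
    Tendsto (fun T : ℕ => ENNReal.ofReal (Real.exp (-(diskArea δ * T)))) atTop (𝓝 0) := by
  rw [← ENNReal.ofReal_zero]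
  refine ENNReal.tendsto_ofReal (Real.tendsto_exp_neg_atTop_nhds_zero.comp ?_)
  exact tendsto_natCast_atTop_atTop.const_mul_atTop (diskArea_pos hδ)

theorem ae_exists_leaf {𝒳 : Measure (ClosedSets Plane)} (h : IsDeadLeaves P x t X 𝒳) (c : Plane)
    {δ : ℝ} (hδ : 0 < δ) :
    ∀ᵐ ω ∂P, ∃ T : ℕ, ∃ i, x i ω ∈ Metric.ball c δ ∧ t i ω ∈ Ioo (-T : ℝ) 0 := by
  rw [ae_iff]
  refine le_antisymm (ge_of_tendsto' (tendsto_exp_neg_diskArea_mul hδ) fun T => ?_) zero_le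
  rw [← measure_no_leaf h c δ T]
  exact measure_mono fun ω hω i hi => hω ⟨T, i, hi⟩

theorem ae_ball_subset_grain (hM : IsDeadLeaves P x t X (grainLaw α r₀ r₁ 𝒴)) (hr₀ : 0 < r₀)
    (ha₁ : 0 < a₁) (hY : ∀ᵐ (F : ClosedSets Plane) ∂𝒴,
      Metric.closedBall (0 : Plane) a₁ ⊆ (F : Set Plane) ∧
        (F : Set Plane) ⊆ Metric.closedBall 0 a₂) :
    ∀ᵐ ω ∂P, ∀ i, Metric.ball (0 : Plane) (r₀ * a₁) ⊆ (X i ω : Set Plane) := by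
  refine ae_all_iff.2 fun i => ?_
  have h := ae_ball_subset_grainLaw (α := α) (r₁ := r₁) hr₀ ha₁ hY
  rw [← (hM.grain_law i).map_eq] at h
  exact ae_of_ae_map (hM.grain_law i).aemeasurable h

/-- If every grain contains a fixed disk and every small disk is the place of some leaf centre,
then bounded sets are covered in bounded time. -/
theorem exists_cover_of_exists_leaf {x : ℕ → Plane} {t : ℕ → ℝ} {X : ℕ → ClosedSets Plane} {δ : ℝ}
    (hδ : 0 < δ) (hX : ∀ i, Metric.ball (0 : Plane) (δ + δ) ⊆ (X i : Set Plane))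
    (hx : ∀ k, ∃ T : ℕ, ∃ i, x i ∈ Metric.ball (TopologicalSpace.denseSeq Plane k) δ ∧
      t i ∈ Ioo (-T : ℝ) 0) (n : ℕ) :
    ∃ T : ℕ, ∀ y ∈ Metric.closedBall (0 : Plane) n,
      ∃ j, t j ∈ Ioo (-T : ℝ) 0 ∧ y ∈ x j +ᵥ interior (X j : Set Plane) := by
  choose T i hi hti using hx
  obtain ⟨s, hs⟩ := (isCompact_closedBall (0 : Plane) n).elim_finite_subcover
    (fun k => Metric.ball (TopologicalSpace.denseSeq Plane k) δ) (fun _ => Metric.isOpen_ball)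
    fun y _ => by
      obtain ⟨k, hk⟩ := (TopologicalSpace.denseRange_denseSeq Plane).exists_dist_lt y hδ
      exact mem_iUnion.2 ⟨k, hk⟩
  refine ⟨s.sup T, fun y hy => ?_⟩
  obtain ⟨k, hks, hk⟩ := mem_iUnion₂.1 (hs hy)
  refine ⟨i k, ⟨lt_of_le_of_lt ?_ (hti k).1, (hti k).2⟩, ?_⟩
  · have : T k ≤ s.sup T := Finset.le_sup hks
    have : (T k : ℝ) ≤ (s.sup T : ℕ) := by exact_mod_cast this
    linarith
  · refine mem_vadd_set.2 ⟨y - x (i k), ?_, by simp⟩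
    refine interior_maximal (hX (i k)) Metric.isOpen_ball ?_
    rw [mem_ball_zero_iff, ← dist_eq_norm]
    exact (dist_triangle_right _ _ _).trans_lt (add_lt_add hk (hi k))

theorem measurableSet_infEDist_sub (p : Plane) {B : Set ℝ≥0∞} (hB : MeasurableSet B) :
    MeasurableSet {z : (Plane × ℝ) × ClosedSets Plane |
      Metric.infEDist (p - z.1.1) (z.2 : Set Plane) ∈ B} := by
  have hm : Measurable fun z : (Plane × ℝ) × ClosedSets Plane => (p - z.1.1, z.2) :=
    (measurable_const.sub (measurable_fst.comp measurable_fst)).prodMk measurable_snd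
  exact (ClosedSets.measurable_infEDist_uncurry.comp hm) hB

theorem measurableSet_time (T : ℕ) :
    MeasurableSet {z : (Plane × ℝ) × ClosedSets Plane | z.1.2 ∈ Icc (-T : ℝ) 0} :=
  (measurable_snd.comp measurable_fst) measurableSet_Icc

/-- Only finitely many leaves of a bounded time interval hit a bounded set, because the squared
radius of the grains has finite expectation. -/
theorem ae_finite_hitting [IsProbabilityMeasure P]
    (hα : (1 < α ∧ α ≤ 3 ∧ 0 < r₁ ∧ r₁ < ∞) ∨ (3 < α ∧ 0 < r₁))
    (hM : IsDeadLeaves P x t X (grainLaw α r₀ r₁ 𝒴)) (hr₀ : 0 < r₀) (ha₂ : 0 < a₂)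
    (hY : ∀ᵐ (F : ClosedSets Plane) ∂𝒴, Metric.closedBall (0 : Plane) a₁ ⊆ (F : Set Plane) ∧
      (F : Set Plane) ⊆ Metric.closedBall 0 a₂) (n T : ℕ) :
    ∀ᵐ ω ∂P, {i | t i ω ∈ Icc (-T : ℝ) 0 ∧
      ((x i ω +ᵥ (X i ω : Set Plane)) ∩ Metric.closedBall 0 n).Nonempty}.Finite := by
  let S : Set ((Plane × ℝ) × ClosedSets Plane) := {z | z.1.2 ∈ Icc (-T : ℝ) 0} ∩
    {z | Metric.infEDist (0 - z.1.1) (z.2 : Set Plane) ∈ Iic (n : ℝ≥0∞)}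
  have hS : MeasurableSet S :=
    (measurableSet_time T).inter (measurableSet_infEDist_sub 0 measurableSet_Iic)
  have hbound := prod_grainLaw_le (α := α) (r₁ := r₁) hr₀ ha₂ hY hS hr₀
    (C := ENNReal.ofReal ((n / r₀ + a₂) ^ 2) * (volume (Metric.ball (0 : Plane) 1) * T))
    fun r F hr hF => by
      have hr' : 0 < r := hr₀.trans_le hr
      -- since `r ≥ r₀`, the radius `n + r a₂` of the set of positions is at most a multiple of `r`
      have hn : (n : ℝ) ≤ r * (n / r₀) := by
        rw [mul_div_assoc', le_div_iff₀ hr₀, mul_comm]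
        gcongr
      calc (volume : Measure (Plane × ℝ)) {z | (z, F) ∈ S}
          ≤ volume (Metric.closedBall (0 : Plane) (r * (n / r₀ + a₂)) ×ˢ Icc (-T : ℝ) 0) := by
            refine measure_mono fun z hz => ⟨?_, hz.1⟩
            have hz2 : ENNReal.ofReal (‖z.1‖ - r * a₂) ≤ n := by
              refine le_trans (Metric.le_infEDist.2 fun y hy => ?_) (mem_Iic.1 hz.2)
              rw [edist_dist, zero_sub, dist_eq_norm]
              refine ENNReal.ofReal_le_ofReal ?_
              have h1 : ‖y‖ ≤ r * a₂ := mem_closedBall_zero_iff.1 (hF hy)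
              have h2 := norm_sub_norm_le (-z.1) y
              rw [norm_neg] at h2
              linarith
            rw [← ENNReal.ofReal_natCast, ENNReal.ofReal_le_ofReal_iff (Nat.cast_nonneg n)] at hz2
            rw [mem_closedBall_zero_iff]
            linarith
        _ = _ := by
            rw [volume_closedBall_prod_Icc _ (by positivity), indicator_of_mem (mem_Ici.2 hr),
              mul_pow, ENNReal.ofReal_mul (by positivity)]
            ring
  have hfin : ∑' i, P {ω | ((x i ω, t i ω), X i ω) ∈ S} ≠ ∞ := by
    refine ((hM.tsum_measure_le hS).trans hbound).trans_lt ?_ |>.ne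
    exact ENNReal.mul_lt_top (ENNReal.mul_lt_top ENNReal.ofReal_lt_top
      (ENNReal.mul_lt_top measure_ball_lt_top (ENNReal.natCast_lt_top T)))
      (ENNReal.mul_lt_top ENNReal.ofReal_lt_top (powerMoment_lt_top hα hr₀))
  filter_upwards [ae_finite_setOfPred_mem hfin] with ω hω
  refine hω.subset ?_
  rintro i ⟨hti, y, ⟨u, hu, rfl⟩, hy⟩
  refine ⟨hti, (Metric.infEDist_le_edist_of_mem hu).trans ?_⟩
  rw [edist_dist, zero_sub, dist_eq_norm, ← ENNReal.ofReal_natCast, ← norm_neg, neg_sub,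
    sub_neg_eq_add, add_comm]
  exact ENNReal.ofReal_le_ofReal (mem_closedBall_zero_iff.1 hy)

theorem ae_isLocallyFiniteCover [IsProbabilityMeasure P]
    (hα : (1 < α ∧ α ≤ 3 ∧ 0 < r₁ ∧ r₁ < ∞) ∨ (3 < α ∧ 0 < r₁))
    (hM : IsDeadLeaves P x t X (grainLaw α r₀ r₁ 𝒴)) (hr₀ : 0 < r₀) (ha₁ : 0 < a₁) (ha₂ : 0 < a₂)
    (hY : ∀ᵐ (F : ClosedSets Plane) ∂𝒴, Metric.closedBall (0 : Plane) a₁ ⊆ (F : Set Plane) ∧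
      (F : Set Plane) ⊆ Metric.closedBall 0 a₂) :
    ∀ᵐ ω ∂P, IsLocallyFiniteCover (fun i => x i ω) (fun i => t i ω) (fun i => X i ω) := by
  -- a leaf centred in a disk of this radius covers the disk
  have hδ : 0 < r₀ * a₁ / 2 := by positivity
  filter_upwards [ae_ball_subset_grain hM hr₀ ha₁ hY,
    ae_all_iff.2 fun k => ae_exists_leaf hM (TopologicalSpace.denseSeq Plane k) hδ,
    ae_all_iff.2 fun n => ae_all_iff.2 fun T => ae_finite_hitting hα hM hr₀ ha₂ hY n T]
    with ω hX hx hfin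
  exact ⟨exists_cover_of_exists_leaf hδ (by simpa only [add_halves] using hX) hx, hfin⟩

/-! ### Disks inside a visible part -/

/-- A leaf containing a given disk has radius bounded below, so the expected number of such leaves
in a bounded time interval is at most the normalizing constant times a quantity that does not
depend on `r₀`. -/
theorem measure_exists_closedBall_subset_leaf_le [IsProbabilityMeasure P]
    (hM : IsDeadLeaves P x t X (grainLaw α r₀ r₁ 𝒴)) (hr₀ : 0 < r₀) (ha₂ : 0 < a₂)
    (hY : ∀ᵐ (F : ClosedSets Plane) ∂𝒴, Metric.closedBall (0 : Plane) a₁ ⊆ (F : Set Plane) ∧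
      (F : Set Plane) ⊆ Metric.closedBall 0 a₂) (c : Plane) {ρ : ℝ} (hρ : 0 < ρ) (T : ℕ) :
    P {ω | ∃ i, t i ω ∈ Icc (-T : ℝ) 0 ∧
        Metric.closedBall c ρ ⊆ x i ω +ᵥ (X i ω : Set Plane)} ≤
      ENNReal.ofReal (a₂ ^ 2) * (volume (Metric.ball (0 : Plane) 1) * T) *
        (ENNReal.ofReal (sizeConst α r₀ r₁) * powerMoment α (ρ / a₂) r₁) := by
  -- two opposite points of the disk are enough to bound the radius of the leaf from below
  obtain ⟨e, he⟩ := exists_norm_eq Plane hρ.le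
  let S : Set ((Plane × ℝ) × ClosedSets Plane) := {z | z.1.2 ∈ Icc (-T : ℝ) 0} ∩
    ({z | Metric.infEDist (c + e - z.1.1) (z.2 : Set Plane) ∈ ({0} : Set ℝ≥0∞)} ∩
      {z | Metric.infEDist (c - e - z.1.1) (z.2 : Set Plane) ∈ ({0} : Set ℝ≥0∞)})
  have hS : MeasurableSet S := (measurableSet_time T).inter
    ((measurableSet_infEDist_sub _ (measurableSet_singleton 0)).inter
      (measurableSet_infEDist_sub _ (measurableSet_singleton 0)))
  have hSmem (z : Plane × ℝ) (F : ClosedSets Plane) : (z, F) ∈ S ↔ z.2 ∈ Icc (-T : ℝ) 0 ∧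
      c + e - z.1 ∈ (F : Set Plane) ∧ c - e - z.1 ∈ (F : Set Plane) := by
    simp only [Metric.mem_iff_infEDist_zero_of_closed F.isClosed]
    rfl
  have hbound := prod_grainLaw_le (α := α) (r₁ := r₁) hr₀ ha₂ hY hS (div_pos hρ ha₂)
    (C := ENNReal.ofReal (a₂ ^ 2) * (volume (Metric.ball (0 : Plane) 1) * T))
    fun r F hr hF => by
      have hr' : 0 < r := hr₀.trans_le hr
      by_cases hρr : ρ / a₂ ≤ r
      · calc (volume : Measure (Plane × ℝ)) {z | (z, F) ∈ S}
            ≤ volume (Metric.closedBall (c + e) (r * a₂) ×ˢ Icc (-T : ℝ) 0) := by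
              refine measure_mono fun z hz => ?_
              obtain ⟨hz1, hz2, -⟩ := (hSmem z F).1 hz
              refine ⟨?_, hz1⟩
              rw [Metric.mem_closedBall', dist_eq_norm]
              exact mem_closedBall_zero_iff.1 (hF hz2)
          _ = _ := by
              rw [volume_closedBall_prod_Icc _ (by positivity),
                indicator_of_mem (mem_Ici.2 hρr), mul_pow, ENNReal.ofReal_mul (by positivity)]
              ring
      · -- the two points are at distance `2 ρ`, more than the diameter of the leaf
        have : {z | (z, F) ∈ S} = ∅ := by
          refine eq_empty_iff_forall_notMem.2 fun z hz => hρr ?_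
          obtain ⟨-, h1, h2⟩ := (hSmem z F).1 hz
          have h1' : ‖c + e - z.1‖ ≤ r * a₂ := mem_closedBall_zero_iff.1 (hF h1)
          have h2' : ‖c - e - z.1‖ ≤ r * a₂ := mem_closedBall_zero_iff.1 (hF h2)
          have h3 := norm_sub_le (c + e - z.1) (c - e - z.1)
          have h4 : (c + e - z.1) - (c - e - z.1) = (2 : ℝ) • e := by
            rw [two_smul]
            abel
          rw [h4, norm_smul, he, Real.norm_ofNat] at h3
          rw [div_le_iff₀ ha₂]
          linarith
        rw [this, measure_empty]
        exact zero_le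
  calc _ ≤ P (⋃ i, {ω | ((x i ω, t i ω), X i ω) ∈ S}) := by
        refine measure_mono ?_
        rintro ω ⟨i, hti, hi⟩
        refine mem_iUnion.2 ⟨i, (hSmem _ _).2 ⟨hti, ?_, ?_⟩⟩
        · obtain ⟨u, hu, hue⟩ := mem_vadd_set.1
            (hi (show c + e ∈ Metric.closedBall c ρ by simp [he]))
          rwa [← hue, vadd_eq_add, add_sub_cancel_left]
        · obtain ⟨u, hu, hue⟩ := mem_vadd_set.1
            (hi (show c - e ∈ Metric.closedBall c ρ by simp [he]))
          rwa [← hue, vadd_eq_add, add_sub_cancel_left]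
    _ ≤ _ := (measure_iUnion_le _).trans ((hM.tsum_measure_le hS).trans hbound)

/-- A visible disk belongs to a recent leaf, or else no recent leaf is centred in the disk. -/
theorem measure_exists_closedBall_subset_visiblePart_le [IsProbabilityMeasure P]
    (hM : IsDeadLeaves P x t X (grainLaw α r₀ r₁ 𝒴)) (hr₀ : 0 < r₀) (ha₁ : 0 < a₁) (ha₂ : 0 < a₂)
    (hY : ∀ᵐ (F : ClosedSets Plane) ∂𝒴, Metric.closedBall (0 : Plane) a₁ ⊆ (F : Set Plane) ∧
      (F : Set Plane) ⊆ Metric.closedBall 0 a₂) (c : Plane) {ρ : ℝ} (hρ : 0 < ρ) (T : ℕ) :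
    P {ω | ∃ i, t i ω ≤ 0 ∧ Metric.closedBall c ρ ⊆
        visiblePart (fun i => x i ω) (fun i => t i ω) (fun i => X i ω) i} ≤
      ENNReal.ofReal (Real.exp (-(diskArea ρ * T))) +
      ENNReal.ofReal (a₂ ^ 2) * (volume (Metric.ball (0 : Plane) 1) * T) *
        (ENNReal.ofReal (sizeConst α r₀ r₁) * powerMoment α (ρ / a₂) r₁) := by
  rw [← measure_no_leaf hM c ρ T]
  refine le_trans (measure_mono_ae ?_) ((measure_union_le _ _).trans
    (add_le_add le_rfl (measure_exists_closedBall_subset_leaf_le hM hr₀ ha₂ hY c hρ T)))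
  filter_upwards [ae_ball_subset_grain hM hr₀ ha₁ hY] with ω hX
  rintro ⟨i, hti, hi⟩
  by_cases hT : -T ≤ t i ω
  · exact Or.inr ⟨i, ⟨hT, hti⟩, hi.trans sdiff_subset⟩
  · refine Or.inl fun j hj => ?_
    refine (hi (Metric.ball_subset_closedBall hj.1)).2 (mem_iUnion₂.2
      ⟨j, ⟨(not_le.1 hT).trans hj.2.1, hj.2.2⟩, mem_vadd_set.2 ⟨0, ?_, by simp⟩⟩)
    exact interior_maximal (hX j) Metric.isOpen_ball (Metric.mem_ball_self (by positivity))

end DeadLeaves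

/-! ### Weak convergence to the whole space -/

/-- Random closed sets converge weakly to the whole space if the probability of missing any given
ball tends to zero: the neighbourhoods of the whole space are generated by hitting conditions. -/
theorem ClosedSets.tendstoInDistribution_univ {E ι : Type*} [MetricSpace E] {L : Filter ι}
    [L.IsCountablyGenerated] {Ω : ι → Type*} [∀ i, MeasurableSpace (Ω i)]
    {P : ∀ i, Measure (Ω i)} [∀ i, IsProbabilityMeasure (P i)] {B : ∀ i, Ω i → ClosedSets E}
    (hB : ∀ i, AEMeasurable (B i) (P i))
    (h : ∀ (c : E) (r : ℝ), 0 < r →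
      Tendsto (fun i => P i {ω | B i ω ∉ hitting (Metric.ball c r)}) L (𝓝 0)) :
    TendstoInDistribution B L (fun _ : Unit => mk (univ : Set E) isClosed_univ) P
      (Measure.dirac ()) := by
  have key (U : Set (ClosedSets E)) (hU : IsOpen U) (hmem : mk (univ : Set E) isClosed_univ ∈ U) :
      Tendsto (fun i => P i {ω | B i ω ∉ U}) L (𝓝 0) := by
    induction hU with
    | basic U hU =>
      rcases hU with ⟨K, -, rfl⟩ | ⟨G, hG, rfl⟩
      · -- the whole space misses the empty set only
        have hK : K = ∅ := by simpa [missing] using hmem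
        simpa [hK, missing] using tendsto_const_nhds
      · obtain ⟨c, -, hc⟩ := hmem
        obtain ⟨r, hr, hrG⟩ := Metric.isOpen_iff.1 hG c hc
        refine tendsto_of_tendsto_of_tendsto_of_le_of_le tendsto_const_nhds (h c r hr)
          (fun _ => zero_le) fun i => measure_mono fun ω hω hω' => hω ?_
        exact hω'.mono (inter_subset_inter_right _ hrG)
    | univ => simpa using tendsto_const_nhds
    | inter U V _ _ ihU ihV =>
      have := (ihU hmem.1).add (ihV hmem.2)
      rw [add_zero] at this
      refine tendsto_of_tendsto_of_tendsto_of_le_of_le tendsto_const_nhds this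
        (fun _ => zero_le) fun i => (measure_mono fun ω hω => ?_).trans (measure_union_le _ _)
      exact not_and_or.1 hω
    | sUnion 𝒰 _ ih =>
      obtain ⟨U, hU, hmemU⟩ := hmem
      refine tendsto_of_tendsto_of_tendsto_of_le_of_le tendsto_const_nhds (ih U hU hmemU)
        (fun _ => zero_le) fun i => measure_mono fun ω hω hω' => hω ⟨U, hU, hω'⟩
  refine ⟨hB, measurable_const.aemeasurable, ?_⟩
  rcases L.eq_or_neBot with rfl | hL
  · exact tendsto_bot
  refine tendsto_of_forall_isOpen_le_liminf' fun U hU => ?_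
  simp only [ProbabilityMeasure.coe_mk]
  rw [Measure.map_apply measurable_const hU.measurableSet]
  by_cases hmem : mk (univ : Set E) isClosed_univ ∈ U
  · have h1 : Tendsto (fun i => (P i).map (B i) U) L (𝓝 1) := by
      have h2 := ENNReal.Tendsto.sub (tendsto_const_nhds (x := (1 : ℝ≥0∞))) (key U hU hmem)
        (Or.inl ENNReal.one_ne_top)
      rw [tsub_zero] at h2
      refine h2.congr fun i => ?_
      have := Measure.isProbabilityMeasure_map (hB i)
      have h3 : P i {ω | B i ω ∉ U} = (P i).map (B i) Uᶜ :=
        (Measure.map_apply_of_aemeasurable (hB i) hU.measurableSet.compl).symm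
      rw [h3, ← prob_compl_eq_one_sub hU.measurableSet.compl, compl_compl]
    rw [h1.liminf_eq]
    exact prob_le_one
  · have : (fun _ : Unit => mk (univ : Set E) isClosed_univ) ⁻¹' U = ∅ :=
      preimage_const_of_notMem hmem
    rw [this, measure_empty]
    exact zero_le

theorem mainTheorem8 (α : ℝ) (r₁ : ℝ≥0∞)
    (hα : (1 < α ∧ α ≤ 3 ∧ 0 < r₁ ∧ r₁ < ∞) ∨ (3 < α ∧ 0 < r₁))
    -- the distribution of the random compact set `Y`
    (𝒴 : Measure (ClosedSets Plane)) [IsProbabilityMeasure 𝒴]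
    (hY : ∃ a₁ a₂ : ℝ, 0 < a₁ ∧ a₁ < a₂ ∧ ∀ᵐ (F : ClosedSets Plane) ∂𝒴,
      Metric.closedBall (0 : Plane) a₁ ⊆ (F : Set Plane) ∧ (F : Set Plane) ⊆ Metric.closedBall 0 a₂)
    -- for every `r₀ ∈ (0, r₁)`, a realization of the dead leaves model with grain `R Y`
    (Ω : {r₀ : ℝ // 0 < r₀ ∧ ENNReal.ofReal r₀ < r₁} → Type*) [∀ r₀, MeasurableSpace (Ω r₀)]
    (P : ∀ r₀, Measure (Ω r₀)) [∀ r₀, IsProbabilityMeasure (P r₀)]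
    (x : ∀ r₀, ℕ → Ω r₀ → Plane) (t : ∀ r₀, ℕ → Ω r₀ → ℝ)
    (X : ∀ r₀, ℕ → Ω r₀ → ClosedSets Plane)
    (hM : ∀ r₀, IsDeadLeaves (P r₀) (x r₀) (t r₀) (X r₀) (grainLaw α r₀ r₁ 𝒴)) :
    -- the union of the boundaries of the visible parts is almost surely closed
    (∀ r₀, ∀ᵐ ω ∂(P r₀),
      IsClosed (boundarySet (fun i => x r₀ i ω) (fun i => t r₀ i ω) (fun i => X r₀ i ω))) ∧
    -- as a random closed set it converges weakly to the whole plane as `r₀ → 0`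
    TendstoInDistribution
      (fun r₀ ω => boundary (fun i => x r₀ i ω) (fun i => t r₀ i ω) (fun i => X r₀ i ω))
      (comap Subtype.val (𝓝 (0 : ℝ)))
      (fun _ : Unit => ClosedSets.mk (univ : Set Plane) isClosed_univ) P (Measure.dirac ()) ∧
    -- the probability that a given disk lies inside a visible part tends to `0`
    (∀ (c : Plane) (r : ℝ), 0 < r →
      Tendsto (fun r₀ => P r₀ {ω | ∃ i, t r₀ i ω ≤ 0 ∧ Metric.closedBall c r ⊆ interior
          (visiblePart (fun i => x r₀ i ω) (fun i => t r₀ i ω) (fun i => X r₀ i ω) i)})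
        (comap Subtype.val (𝓝 (0 : ℝ))) (𝓝 0)) := by
  obtain ⟨a₁, a₂, ha₁, ha₁₂, hY⟩ := hY
  have ha₂ : 0 < a₂ := ha₁.trans ha₁₂
  have hα1 : 1 < α := by
    rcases hα with h | h
    exacts [h.1, by linarith [h.1]]
  have hcover (r₀ : {r₀ : ℝ // 0 < r₀ ∧ ENNReal.ofReal r₀ < r₁}) :=
    ae_isLocallyFiniteCover hα (hM r₀) r₀.2.1 ha₁ ha₂ hY
  have hconst : Tendsto (fun r₀ : {r₀ : ℝ // 0 < r₀ ∧ ENNReal.ofReal r₀ < r₁} =>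
      ENNReal.ofReal (sizeConst α r₀ r₁)) (comap Subtype.val (𝓝 (0 : ℝ))) (𝓝 0) := by
    rw [← ENNReal.ofReal_zero]
    exact ENNReal.tendsto_ofReal ((tendsto_sizeConst hα1 r₁).comp
      (tendsto_nhdsWithin_iff.2 ⟨tendsto_comap, Eventually.of_forall fun r₀ => r₀.2.1⟩))
  have hdisk (c : Plane) (r : ℝ) (hr : 0 < r) :
      Tendsto (fun r₀ => P r₀ {ω | ∃ i, t r₀ i ω ≤ 0 ∧ Metric.closedBall c r ⊆ interior
          (visiblePart (fun i => x r₀ i ω) (fun i => t r₀ i ω) (fun i => X r₀ i ω) i)})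
        (comap Subtype.val (𝓝 (0 : ℝ))) (𝓝 0) := by
    rw [ENNReal.tendsto_nhds_zero]
    intro ε hε
    -- a time span in which, with probability close to one, some leaf is centred in the disk
    obtain ⟨T, hT⟩ := ((ENNReal.tendsto_nhds_zero.1 (tendsto_exp_neg_diskArea_mul hr)) (ε / 2)
      (ENNReal.half_pos hε.ne')).exists
    have hlim : Tendsto (fun r₀ : {r₀ : ℝ // 0 < r₀ ∧ ENNReal.ofReal r₀ < r₁} =>
        ENNReal.ofReal (a₂ ^ 2) * (volume (Metric.ball (0 : Plane) 1) * T) *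
          (ENNReal.ofReal (sizeConst α r₀ r₁) * powerMoment α (r / a₂) r₁))
        (comap Subtype.val (𝓝 (0 : ℝ))) (𝓝 0) := by
      have h1 := ENNReal.Tendsto.mul_const hconst
        (Or.inr (powerMoment_lt_top hα (div_pos hr ha₂)).ne)
      have h2 := ENNReal.Tendsto.const_mul
        (a := ENNReal.ofReal (a₂ ^ 2) * (volume (Metric.ball (0 : Plane) 1) * T)) h1
        (Or.inr (ENNReal.mul_ne_top ENNReal.ofReal_ne_top
          (ENNReal.mul_ne_top measure_ball_lt_top.ne (ENNReal.natCast_ne_top T))))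
      simpa only [zero_mul, mul_zero] using h2
    filter_upwards [ENNReal.tendsto_nhds_zero.1 hlim (ε / 2) (ENNReal.half_pos hε.ne')] with r₀ h₀
    calc _ ≤ P r₀ {ω | ∃ i, t r₀ i ω ≤ 0 ∧ Metric.closedBall c r ⊆
          visiblePart (fun i => x r₀ i ω) (fun i => t r₀ i ω) (fun i => X r₀ i ω) i} :=
          measure_mono fun ω => Exists.imp fun i => And.imp_right fun hc =>
            hc.trans interior_subset
      _ ≤ ε / 2 + ε / 2 := (measure_exists_closedBall_subset_visiblePart_le (hM r₀) r₀.2.1 ha₁ ha₂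
          hY c hr T).trans (add_le_add hT h₀)
      _ = ε := ENNReal.add_halves ε
  refine ⟨fun r₀ => (hcover r₀).mono fun ω hω => hω.isClosed_boundarySet, ?_, hdisk⟩
  refine ClosedSets.tendstoInDistribution_univ (fun r₀ => aemeasurable_boundary
    (hM r₀).measurable_position (hM r₀).measurable_time
    fun i => ((hM r₀).grain_law i).aemeasurable) fun c r hr => ?_
  refine tendsto_of_tendsto_of_tendsto_of_le_of_le tendsto_const_nhds
    (hdisk c (r / 2) (half_pos hr)) (fun _ => zero_le) fun r₀ => measure_mono_ae ?_
  filter_upwards [hcover r₀] with ω hω hmiss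
  have hdisj : Disjoint (boundarySet (fun i => x r₀ i ω) (fun i => t r₀ i ω) fun i => X r₀ i ω)
      (Metric.ball c r) := by
    rw [disjoint_iff_inter_eq_empty, ← not_nonempty_iff_eq_empty]
    exact fun h => hmiss (h.mono (inter_subset_inter_left _ subset_closure))
  obtain ⟨i, hi, hsub⟩ := hω.exists_ball_subset_interior hr hdisj
  exact ⟨i, hi, (Metric.closedBall_subset_ball (half_lt_self hr)).trans hsub⟩
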